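/- Let $\lambda=(1+\sqrt{13})/2$ and let $\varrho$ be the substitution $0\mapsto 0111$, $1\mapsto 0$. Let $w$ be the bi-infinite fixed point of $\varrho^2$ with seed $0|0$, turn $w$ into a tiling of $\mathbb{R}$ by intervals of length $\lambda$ (type $0$) and length $1$ (type $1$), with the marker at the origin, and let $\varLambda^w$ be the set of left endpoints of the intervals. Let $\mathbb{Y}$ be the hull of $\varLambda^w$, that is, the closure of $\{t+\varLambda^w : t\in\mathbb{R}\}$ in the local topology. For $\varLambda\in\mathbb{Y}$ let $\varLambda=\varLambda^{(0)}\,\dot\cup\,\varLambda^{(1)}$ be the partition of the points according to the type of the interval that starts there, write $A_r=A\cap[-r,r]$, and let $$\nu_{ij}(z)=\lim_{r\to\infty}\frac{\mathrm{card}\bigl(\varLambda^{(i)}_r\cap(\varLambda^{(j)}_r-z)\bigr)}{\mathrm{card}(\varLambda_r)},\qquad i,j\in\{0,1\},\ z\in\mathbb{R},$$ be the pair correlation functions. Then, for every $\varLambda\in\mathbb{Y}$, these limits exist, the support $\{z\in\mathbb{R}:\nu_{ij}(z)\neq 0\}$ of $\nu_{ij}$ is $\varLambda^{(j)}-\varLambda^{(i)}$,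 and for all $z\in\mathbb{R}$ $$\nu_{00}(z)=\tfrac1\lambda\Bigl(\nu_{00}\bigl(\tfrac z\lambda\bigr)+\nu_{01}\bigl(\tfrac z\lambda\bigr)+\nu_{10}\bigl(\tfrac z\lambda\bigr)+\nu_{11}\bigl(\tfrac z\lambda\bigr)\Bigr),$$ $$\nu_{01}(z)=\tfrac1\lambda\sum_{k=0}^{2}\Bigl(\nu_{00}\bigl(\tfrac{z-k-\lambda}\lambda\bigr)+\nu_{10}\bigl(\tfrac{z-k-\lambda}\lambda\bigr)\Bigr),$$ $$\nu_{10}(z)=\tfrac1\lambda\sum_{k=0}^{2}\Bigl(\nu_{00}\bigl(\tfrac{z+k+\lambda}\lambda\bigr)+\nu_{01}\bigl(\tfrac{z+k+\lambda}\lambda\bigr)\Bigr),$$ $$\nu_{11}(z)=\tfrac1\lambda\Bigl(3\nu_{00}\bigl(\tfrac z\lambda\bigr)+2\nu_{00}\bigl(\tfrac{z+1}\lambda\bigr)+2\nu_{00}\bigl(\tfrac{z-1}\lambda\bigr)+\nu_{00}\bigl(\tfrac{z+2}\lambda\bigr)+\nu_{00}\bigl(\tfrac{z-2}\lambda\bigr)\Bigr).$$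 Moreover, the real vector space of all families $(\nu_{ij})_{i,j\in\{0,1\}}$ of functions $\nu_{ij}\colon\mathbb{R}\to\mathbb{R}$ that satisfy these four equations for all $z\in\mathbb{R}$ and vanish outside $\varLambda^{(j)}-\varLambda^{(i)}$, respectively, is one-dimensional. -/

import Mathlib

open Filter Topology

namespace InflationTiling

/-- The inflation factor `λ = (1 + √13) / 2`, the positive root of `x ^ 2 = x + 3`. -/
noncomputable def lam : ℝ := (1 + Real.sqrt 13) / 2

/-- The substitution `0 ↦ 0111`, `1 ↦ 0` on letters. -/
def substLetter : Fin 2 → List (Fin 2)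
  | 0 => [0, 1, 1, 1]
  | 1 => [0]

/-- The substitution on finite words. -/
def subst (u : List (Fin 2)) : List (Fin 2) := u.flatMap substLetter

/-- The word obtained from the letter `0` by `n` applications of the square of the substitution.
Each of these words is both a prefix and a suffix of the next one. -/
def superWord (n : ℕ) : List (Fin 2) := (subst ∘ subst)^[n] [0]

/-- The bi-infinite fixed point of the square of the substitution with legal seed `0|0`; the
marker `|` sits between the positions `-1` and `0`. The right half is the limit of the words
`superWord k` aligned at their first letters, the left half their limit aligned at their last
letters. As `superWord n` has more than `n` letters, the letter at position `n` of the right half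
(the `n`-th letter from the marker in the left half) can be read off from `superWord n`. -/
def fixedPoint : ℤ → Fin 2
  | Int.ofNat n => (superWord n).getD n 0
  | Int.negSucc n => (superWord n).reverse.getD n 0

/-- The natural interval lengths: `λ` for type `0` and `1` for type `1`. -/
noncomputable def tileLength : Fin 2 → ℝ
  | 0 => lam
  | 1 => 1

/-- The left endpoint of the `n`-th interval of the tiling given by the fixed point; the `0`-th
interval starts at the origin. (For every `n`, at least one of the two sums is empty.) -/
noncomputable def leftEndpoint (n : ℤ) : ℝ :=
  ∑ k ∈ Finset.Ico 0 n, tileLength (fixedPoint k) - ∑ k ∈ Finset.Ico n 0, tileLength (fixedPoint k)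

/-- The Delone set of left endpoints of the tiling given by the fixed point. -/
def fixedPointSet : Set ℝ := Set.range leftEndpoint

/-- The translate `t + A`. -/
def translate (t : ℝ) (A : Set ℝ) : Set ℝ := (fun x => t + x) '' A

/-- `ε`-closeness of point sets in the local topology: up to a translation by at most `ε`, the
two sets agree on `[-1/ε, 1/ε]`. -/
def LocallyClose (ε : ℝ) (A B : Set ℝ) : Prop :=
  ∃ t : ℝ, |t| ≤ ε ∧
    A ∩ Set.Icc (-(1 / ε)) (1 / ε) = translate t B ∩ Set.Icc (-(1 / ε)) (1 / ε)

/-- The hull: the closure, in the local topology, of the set of all translates of the Delone set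
of the fixed point. -/
def hull : Set (Set ℝ) :=
  {A | ∀ ε : ℝ, 0 < ε → ∃ t : ℝ, LocallyClose ε A (translate t fixedPointSet)}

/-- The points of `A` of type `i`: the left endpoints of the intervals of length `tileLength i`
in the partition of the line into intervals between consecutive points of `A`. -/
def pointsOfType (A : Set ℝ) (i : Fin 2) : Set ℝ :=
  {x | x ∈ A ∧ x + tileLength i ∈ A ∧ A ∩ Set.Ioo x (x + tileLength i) = ∅}

/-- The relative frequency, within `[-r, r]`, of pairs consisting of a point `x` of type `i` and
a point `x + z` of type `j`. -/
noncomputable def pairFrequency (A : Set ℝ) (i j : Fin 2) (z r : ℝ) : ℝ :=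
  (((pointsOfType A i ∩ Set.Icc (-r) r) ∩
      translate (-z) (pointsOfType A j ∩ Set.Icc (-r) r)).ncard : ℝ) /
    ((A ∩ Set.Icc (-r) r).ncard : ℝ)

/-- The pair correlation functions, as limits of pair frequencies. -/
noncomputable def pairCorrelation (A : Set ℝ) (i j : Fin 2) (z : ℝ) : ℝ :=
  limUnder atTop (pairFrequency A i j z)

/-- The set of all differences `y - x` with `y` of type `j` and `x` of type `i`. -/
def typeDifferences (A : Set ℝ) (i j : Fin 2) : Set ℝ :=
  {z | ∃ y ∈ pointsOfType A j, ∃ x ∈ pointsOfType A i, z = y - x}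

/-- The system of linear renormalisation equations for a family of four functions. -/
def Renormalisation (ν : Fin 2 → Fin 2 → ℝ → ℝ) : Prop :=
  (∀ z : ℝ, ν 0 0 z =
    1 / lam * (ν 0 0 (z / lam) + ν 0 1 (z / lam) + ν 1 0 (z / lam) + ν 1 1 (z / lam))) ∧
  (∀ z : ℝ, ν 0 1 z =
    1 / lam * (ν 0 0 ((z - lam) / lam) + ν 0 0 ((z - 1 - lam) / lam)
      + ν 0 0 ((z - 2 - lam) / lam) + ν 1 0 ((z - lam) / lam)
      + ν 1 0 ((z - 1 - lam) / lam) + ν 1 0 ((z - 2 - lam) / lam))) ∧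
  (∀ z : ℝ, ν 1 0 z =
    1 / lam * (ν 0 0 ((z + lam) / lam) + ν 0 0 ((z + 1 + lam) / lam)
      + ν 0 0 ((z + 2 + lam) / lam) + ν 0 1 ((z + lam) / lam)
      + ν 0 1 ((z + 1 + lam) / lam) + ν 0 1 ((z + 2 + lam) / lam))) ∧
  (∀ z : ℝ, ν 1 1 z =
    1 / lam * (3 * ν 0 0 (z / lam) + 2 * ν 0 0 ((z + 1) / lam) + 2 * ν 0 0 ((z - 1) / lam)
      + ν 0 0 ((z + 2) / lam) + ν 0 0 ((z - 2) / lam)))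

/-- The vector space of all solutions of the renormalisation equations that are supported on the
sets of differences between points of the respective types of `A`. -/
def solutionSpace (A : Set ℝ) : Submodule ℝ (Fin 2 → Fin 2 → ℝ → ℝ) where
  carrier := {ν | Renormalisation ν ∧ ∀ i j z, z ∉ typeDifferences A i j → ν i j z = 0}
  zero_mem' := by simp [Renormalisation]
  add_mem' := by
    rintro f g ⟨⟨f1, f2, f3, f4⟩, f5⟩ ⟨⟨g1, g2, g3, g4⟩, g5⟩
    refine ⟨⟨fun z => ?_, fun z => ?_, fun z => ?_, fun z => ?_⟩, fun i j z hz => ?_⟩ <;>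
      simp only [Pi.add_apply]
    · rw [f1, g1]; ring
    · rw [f2, g2]; ring
    · rw [f3, g3]; ring
    · rw [f4, g4]; ring
    · rw [f5 i j z hz, g5 i j z hz, add_zero]
  smul_mem' := by
    rintro c f ⟨⟨f1, f2, f3, f4⟩, f5⟩
    refine ⟨⟨fun z => ?_, fun z => ?_, fun z => ?_, fun z => ?_⟩, fun i j z hz => ?_⟩ <;>
      simp only [Pi.smul_apply, smul_eq_mul]
    · rw [f1]; ring
    · rw [f2]; ring
    · rw [f3]; ring
    · rw [f4]; ring
    · rw [f5 i j z hz, mul_zero]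

end InflationTiling

namespace InflationTiling

/-! Every member of the hull is a legal pattern: each bounded window is part of an inflated seed
`00`. Inflation can be undone locally and uniquely (`IsLegal.deflate`, `IsLegal.mem_iff_deflate`,
`IsLegal.parent_unique`), so every pair of points at distance `z` comes from exactly one pair of
parents at distance `(z + offset - offset') / lam` in the deflated pattern. Counting gives an exact
identity between pair densities in windows of radius `r` and `r / lam` (`density_eq`); in the limit
it becomes the renormalisation equations.

Existence of limits, positivity and uniqueness all follow from one induction
(`InflationInductive.forall_pairs`). Passing to parents contracts differences until they lie in
`(-4, 4)`, where only a few values can occur; these reduce to three cases that depend on themselves: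
type pairs `00` and `11` at distance `0`, and `00` at distance `lam`.

For existence, the three cases are settled by a contraction argument
(`exists_tendsto_of_contraction`), using that the tiles fill the line (`tendsto_length`). The limit
is taken uniformly over all legal patterns (`legalFilter`), because the recursion replaces the
pattern by shifted deflations. For positivity, every difference that occurs in some legal pattern
has positive density in all of them, which determines the supports. For uniqueness, a supported
solution with `ν 0 0 0 = 0` vanishes, so the solution space is a line. -/

/-! ### The inflation factor and the tile lengths -/

lemma lam_sq : lam ^ 2 = lam + 3 := by
  have h : Real.sqrt 13 ^ 2 = 13 := Real.sq_sqrt (by norm_num)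
  unfold lam
  linear_combination h / 4

lemma lt_lam : (2.302 : ℝ) < lam := by
  have h : (3.604 : ℝ) < Real.sqrt 13 := Real.lt_sqrt_of_sq_lt (by norm_num)
  unfold lam
  linarith

lemma lam_lt : lam < (2.303 : ℝ) := by
  have h : Real.sqrt 13 < (3.606 : ℝ) := (Real.sqrt_lt' (by norm_num)).2 (by norm_num)
  unfold lam
  linarith

lemma lam_pos : 0 < lam := by linarith [lt_lam]

lemma one_le_tileLength (i : Fin 2) : 1 ≤ tileLength i := by
  fin_cases i
  · simp [tileLength]; linarith [lt_lam]
  · simp [tileLength]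

lemma tileLength_le (i : Fin 2) : tileLength i ≤ lam := by
  fin_cases i
  · simp [tileLength]
  · simp [tileLength]; linarith [lt_lam]

/-! ### Words as patches of tiles -/

/-- The total length of the intervals of a word. -/
noncomputable def wordLength (u : List (Fin 2)) : ℝ := (u.map tileLength).sum

/-- The left endpoints of the intervals of type `i` in the patch that is given by a word and
starts at `s`. -/
def wordPoints (i : Fin 2) : ℝ → List (Fin 2) → Set ℝ
  | _, [] => ∅
  | s, a :: u => {x | x = s ∧ a = i} ∪ wordPoints i (s + tileLength a) u

/-- The pairs of a letter `a` and a position in `substLetter a` at which the letter `i` sits. -/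
def parents : Fin 2 → Finset (Fin 2 × ℕ)
  | 0 => {(0, 0), (1, 0)}
  | 1 => {(0, 1), (0, 2), (0, 3)}

/-- The left endpoint of the interval at position `k` in an inflated interval. -/
noncomputable def offset : ℕ → ℝ
  | 0 => 0
  | k + 1 => lam + k

@[simp] lemma wordLength_nil : wordLength [] = 0 := rfl

@[simp] lemma wordLength_cons (a : Fin 2) (u : List (Fin 2)) :
    wordLength (a :: u) = tileLength a + wordLength u := by simp [wordLength]

@[simp] lemma wordLength_append (u v : List (Fin 2)) :
    wordLength (u ++ v) = wordLength u + wordLength v := by simp [wordLength]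

@[simp] lemma mem_wordPoints_nil {i : Fin 2} {s x : ℝ} : ¬ x ∈ wordPoints i s [] := id

lemma mem_wordPoints_cons {i a : Fin 2} {s x : ℝ} {u : List (Fin 2)} :
    x ∈ wordPoints i s (a :: u) ↔ (x = s ∧ a = i) ∨ x ∈ wordPoints i (s + tileLength a) u := Iff.rfl

lemma subst_append (u v : List (Fin 2)) : subst (u ++ v) = subst u ++ subst v := by
  simp [subst]

lemma subst_cons (a : Fin 2) (u : List (Fin 2)) : subst (a :: u) = substLetter a ++ subst u := by
  simp [subst]

/-- The tile lengths form a left eigenvector of the substitution matrix: `lam + 3 = lam ^ 2` for the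
image of `0`, and `lam = lam * 1` for the image of `1`. -/
lemma wordLength_subst (u : List (Fin 2)) : wordLength (subst u) = lam * wordLength u := by
  induction u with
  | nil => simp [subst]
  | cons a u ih =>
    rw [subst_cons, wordLength_append, ih, wordLength_cons]
    fin_cases a
    · simp [substLetter, tileLength]; linear_combination -lam_sq
    · simp [substLetter, tileLength]; ring

lemma le_of_mem_wordPoints {i : Fin 2} {s x : ℝ} {u : List (Fin 2)} (h : x ∈ wordPoints i s u) :
    s ≤ x := by
  induction u generalizing s with
  | nil => exact absurd h mem_wordPoints_nil
  | cons a u ih =>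
    rcases mem_wordPoints_cons.1 h with h | h
    · exact h.1.ge
    · linarith [ih h, one_le_tileLength a]

lemma add_le_of_mem_wordPoints {i j : Fin 2} {s x y : ℝ} {u : List (Fin 2)}
    (hx : x ∈ wordPoints i s u) (hy : y ∈ wordPoints j s u) (hxy : x < y) :
    x + tileLength i ≤ y := by
  induction u generalizing s with
  | nil => exact absurd hx mem_wordPoints_nil
  | cons a u ih =>
    rcases mem_wordPoints_cons.1 hx with ⟨rfl, rfl⟩ | hx <;>
      rcases mem_wordPoints_cons.1 hy with ⟨rfl, rfl⟩ | hy
    · exact absurd hxy (lt_irrefl _)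
    · exact le_of_mem_wordPoints hy
    · linarith [le_of_mem_wordPoints hx, one_le_tileLength a]
    · exact ih hx hy

lemma type_unique_of_mem_wordPoints {i j : Fin 2} {s x : ℝ} {u : List (Fin 2)}
    (hx : x ∈ wordPoints i s u) (hy : x ∈ wordPoints j s u) : i = j := by
  induction u generalizing s with
  | nil => exact absurd hx mem_wordPoints_nil
  | cons a u ih =>
    rcases mem_wordPoints_cons.1 hx with ⟨h, rfl⟩ | hx <;>
      rcases mem_wordPoints_cons.1 hy with ⟨h', rfl⟩ | hy
    · rfl
    · linarith [le_of_mem_wordPoints hy, one_le_tileLength a]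
    · linarith [le_of_mem_wordPoints hx, one_le_tileLength a]
    · exact ih hx hy

lemma exists_mem_wordPoints {s y : ℝ} {u : List (Fin 2)} (h1 : s ≤ y)
    (h2 : y < s + wordLength u) :
    ∃ i, ∃ x ∈ wordPoints i s u, x ≤ y ∧ y < x + tileLength i := by
  induction u generalizing s with
  | nil => simp at h2; linarith
  | cons a u ih =>
    rcases lt_or_ge y (s + tileLength a) with h | h
    · exact ⟨a, s, mem_wordPoints_cons.2 (Or.inl ⟨rfl, rfl⟩), h1, h⟩
    · obtain ⟨i, x, hx, h3⟩ := ih h (by rw [wordLength_cons] at h2; linarith)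
      exact ⟨i, x, mem_wordPoints_cons.2 (Or.inr hx), h3⟩

lemma finite_wordPoints (i : Fin 2) (s : ℝ) (u : List (Fin 2)) : (wordPoints i s u).Finite := by
  induction u generalizing s with
  | nil => exact Set.finite_empty
  | cons a u ih =>
    exact ((Set.finite_singleton s).subset fun x hx => hx.1).union (ih _)

lemma exists_sub_of_mem_wordPoints {i : Fin 2} {s x : ℝ} {u : List (Fin 2)}
    (hx : x ∈ wordPoints i s u) : ∃ a b : ℕ, x - s = a * lam + b := by
  induction u generalizing s with
  | nil => exact absurd hx mem_wordPoints_nil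
  | cons c u ih =>
    rcases mem_wordPoints_cons.1 hx with ⟨rfl, rfl⟩ | hx
    · exact ⟨0, 0, by simp⟩
    · obtain ⟨a, b, h⟩ := ih hx
      have hc : c = 0 ∨ c = 1 := by fin_cases c <;> simp
      rcases hc with rfl | rfl
      · refine ⟨a + 1, b, ?_⟩
        simp only [tileLength] at h
        push_cast; linarith
      · refine ⟨a, b + 1, ?_⟩
        simp only [tileLength] at h
        push_cast; linarith

lemma exists_sub_of_mem_wordPoints_of_le {i j : Fin 2} {s x y : ℝ} {u : List (Fin 2)}
    (hx : x ∈ wordPoints i s u) (hy : y ∈ wordPoints j s u) (hxy : x ≤ y) :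
    ∃ a b : ℕ, y - x = a * lam + b := by
  induction u generalizing s with
  | nil => exact absurd hx mem_wordPoints_nil
  | cons c u ih =>
    rcases mem_wordPoints_cons.1 hx with ⟨rfl, rfl⟩ | hx' <;>
      rcases mem_wordPoints_cons.1 hy with ⟨rfl, rfl⟩ | hy'
    · exact ⟨0, 0, by simp⟩
    · exact exists_sub_of_mem_wordPoints hy
    · linarith [le_of_mem_wordPoints hx', one_le_tileLength c]
    · exact ih hx' hy'

/-- Inflation of words becomes an affine relation between point sets, because the image of each tile
ends exactly where the image of the next one starts. -/
lemma mem_wordPoints_subst {i : Fin 2} {s x : ℝ} {u : List (Fin 2)} :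
    x ∈ wordPoints i (lam * s) (subst u) ↔
      ∃ p ∈ parents i, (x - offset p.2) / lam ∈ wordPoints p.1 s u := by
  have hl := lam_pos.ne'
  induction u generalizing s with
  | nil => simp [subst, wordPoints]
  | cons a u ih =>
    have key : ∀ (y c : ℝ), (y - c) / lam = s ↔ y = lam * s + c := fun y c => by
      rw [div_eq_iff hl]; constructor <;> intro h <;> linarith
    rw [subst_cons]
    have ha : a = 0 ∨ a = 1 := by fin_cases a <;> simp
    have hi : i = 0 ∨ i = 1 := by fin_cases i <;> simp
    have h0 : lam * s + tileLength 0 + tileLength 1 + tileLength 1 + tileLength 1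
        = lam * (s + tileLength 0) := by
      simp only [tileLength]; linear_combination -lam_sq
    have h1 : lam * s + tileLength 0 = lam * (s + tileLength 1) := by
      simp only [tileLength]; ring
    rcases ha with rfl | rfl
    · simp only [substLetter, List.cons_append, List.nil_append, mem_wordPoints_cons, h0]
      have ih' : x ∈ wordPoints i (lam * (s + tileLength 0)) (subst u) ↔ ∃ p ∈ parents i,
          (x - offset p.2) / lam ∈ wordPoints p.1 (s + tileLength 0) u := ih
      rw [ih']
      rcases hi with rfl | rfl
      · simp [parents, offset]
        have := key x 0
        simp at this
        tauto
      · simp [parents, offset, key, tileLength, add_assoc]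
        norm_num
        tauto
    · simp only [substLetter, List.cons_append, List.nil_append, mem_wordPoints_cons, h1]
      have ih' : x ∈ wordPoints i (lam * (s + tileLength 1)) (subst u) ↔ ∃ p ∈ parents i,
          (x - offset p.2) / lam ∈ wordPoints p.1 (s + tileLength 1) u := ih
      rw [ih']
      rcases hi with rfl | rfl
      · simp [parents, offset]
        have := key x 0
        simp at this
        tauto
      · simp [parents, offset]

lemma add_mem_wordPoints {i : Fin 2} {s x : ℝ} {u : List (Fin 2)} (hx : x ∈ wordPoints i s u)
    (h : x + tileLength i < s + wordLength u) : ∃ j, x + tileLength i ∈ wordPoints j s u := by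
  obtain ⟨j, y, hy, h1, h2⟩ := exists_mem_wordPoints
    (by linarith [le_of_mem_wordPoints hx, one_le_tileLength i]) h
  rcases h1.eq_or_lt with rfl | h1
  · exact ⟨j, hy⟩
  rcases lt_trichotomy x y with h3 | rfl | h3
  · linarith [add_le_of_mem_wordPoints hx hy h3]
  · obtain rfl := type_unique_of_mem_wordPoints hx hy
    linarith
  · linarith [add_le_of_mem_wordPoints hy hx h3, one_le_tileLength i]

/-! ### Legal patterns and recognisability -/

/-- A pair of sets of points of the two types is legal if, in every bounded window, it agrees with
some inflated seed. -/
def IsLegal (B : Fin 2 → Set ℝ) : Prop :=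
  ∀ R : ℝ, ∃ (n : ℕ) (s : ℝ), s ≤ -R ∧ R < s + wordLength (subst^[n] [0, 0]) ∧
    ∀ i x, |x| ≤ R → (x ∈ B i ↔ x ∈ wordPoints i s (subst^[n] [0, 0]))

/-- The translate of a pair of sets. -/
def shift (t : ℝ) (B : Fin 2 → Set ℝ) (i : Fin 2) : Set ℝ := {x | x - t ∈ B i}

/-- The pair of sets whose inflation is `B`. -/
def deflate (B : Fin 2 → Set ℝ) : Fin 2 → Set ℝ
  | 0 => {x | lam * x ∈ B 0 ∧ lam * x + lam ∈ B 1}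
  | 1 => {x | lam * x ∈ B 0 ∧ lam * x + lam ∈ B 0}

lemma fin_two_cases (i : Fin 2) : i = 0 ∨ i = 1 := by fin_cases i <;> simp

lemma offset_nonneg (k : ℕ) : 0 ≤ offset k := by
  cases k
  · exact le_rfl
  · exact add_nonneg lam_pos.le (Nat.cast_nonneg _)

lemma offset_le {i : Fin 2} {p : Fin 2 × ℕ} (hp : p ∈ parents i) : offset p.2 ≤ lam + 2 := by
  rcases fin_two_cases i with rfl | rfl <;>
    simp only [parents, Finset.mem_insert, Finset.mem_singleton] at hp
  · rcases hp with rfl | rfl <;> simp only [offset] <;> linarith [lam_pos]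
  · rcases hp with rfl | rfl | rfl <;> simp [offset]

namespace IsLegal

variable {B : Fin 2 → Set ℝ}

lemma add_le (hB : IsLegal B) {i j : Fin 2} {x y : ℝ} (hx : x ∈ B i) (hy : y ∈ B j)
    (hxy : x < y) : x + tileLength i ≤ y := by
  obtain ⟨n, s, -, -, h⟩ := hB (max |x| |y|)
  exact add_le_of_mem_wordPoints ((h i x (le_max_left _ _)).1 hx)
    ((h j y (le_max_right _ _)).1 hy) hxy

lemma type_unique (hB : IsLegal B) {i j : Fin 2} {x : ℝ} (hx : x ∈ B i) (hy : x ∈ B j) :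
    i = j := by
  obtain ⟨n, s, -, -, h⟩ := hB |x|
  exact type_unique_of_mem_wordPoints ((h i x le_rfl).1 hx) ((h j x le_rfl).1 hy)

lemma exists_sub_of_le (hB : IsLegal B) {i j : Fin 2} {x y : ℝ} (hx : x ∈ B i) (hy : y ∈ B j)
    (hxy : x ≤ y) : ∃ a b : ℕ, y - x = a * lam + b := by
  obtain ⟨n, s, -, -, h⟩ := hB (max |x| |y|)
  exact exists_sub_of_mem_wordPoints_of_le ((h i x (le_max_left _ _)).1 hx)
    ((h j y (le_max_right _ _)).1 hy) hxy

lemma exists_mem (hB : IsLegal B) (y : ℝ) : ∃ i, ∃ x ∈ B i, x ≤ y ∧ y < x + tileLength i := by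
  obtain ⟨n, s, h1, h2, h⟩ := hB (|y| + lam)
  obtain ⟨i, x, hx, h3, h4⟩ := exists_mem_wordPoints (s := s) (y := y)
    (u := subst^[n] [0, 0]) (by linarith [neg_abs_le y, lam_pos]) (by linarith [le_abs_self y, lam_pos])
  refine ⟨i, x, (h i x ?_).2 hx, h3, h4⟩
  rw [abs_le]
  constructor <;> linarith [neg_abs_le y, le_abs_self y, tileLength_le i, lam_pos]

lemma finite_window (hB : IsLegal B) (i : Fin 2) (R : ℝ) : {x | x ∈ B i ∧ |x| ≤ R}.Finite := by
  obtain ⟨n, s, -, -, h⟩ := hB R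
  exact (finite_wordPoints i s (subst^[n] [0, 0])).subset fun x hx => (h i x hx.2).1 hx.1

lemma mem_shift {t x : ℝ} {i : Fin 2} : x ∈ InflationTiling.shift t B i ↔ x - t ∈ B i := Iff.rfl

end IsLegal

lemma wordPoints_shift (t : ℝ) {i : Fin 2} {s x : ℝ} {u : List (Fin 2)} :
    x ∈ wordPoints i (s + t) u ↔ x - t ∈ wordPoints i s u := by
  induction u generalizing s with
  | nil => simp
  | cons a u ih =>
    have h : s + t + tileLength a = s + tileLength a + t := by ring
    have ih' : x ∈ wordPoints i (s + tileLength a + t) u ↔ x - t ∈ wordPoints i (s + tileLength a) u :=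
      ih
    rw [mem_wordPoints_cons, mem_wordPoints_cons, h, ih', sub_eq_iff_eq_add]

namespace IsLegal

variable {B : Fin 2 → Set ℝ}

lemma shift (hB : IsLegal B) (t : ℝ) : IsLegal (shift t B) := by
  intro R
  obtain ⟨n, s, h1, h2, h⟩ := hB (R + |t|)
  refine ⟨n, s + t, by linarith [le_abs_self t], by linarith [neg_abs_le t], fun i x hx => ?_⟩
  rw [wordPoints_shift, mem_shift]
  exact h i _ ((abs_sub _ _).trans (by linarith))

/-- Recognisability: every `0` starts the image of a tile, of type `0` if a `1` follows and of type
`1` if a `0` follows. A single word `subst^[n] [0, 0]` describes the deflated pattern while its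
image describes `B`, which is what allows the two to be compared. -/
lemma exists_deflate_window (hB : IsLegal B) (R : ℝ) : ∃ (n : ℕ) (t : ℝ), t ≤ -R ∧
    R < t + wordLength (subst^[n] [0, 0]) ∧
    (∀ i x, |x| ≤ lam * (|R| + 2) →
      (x ∈ B i ↔ x ∈ wordPoints i (lam * t) (subst (subst^[n] [0, 0])))) ∧
    ∀ i x, |x| ≤ R → (x ∈ deflate B i ↔ x ∈ wordPoints i t (subst^[n] [0, 0])) := by
  have hl := lam_pos
  obtain ⟨n, s, h1, h2, h⟩ := hB (lam * (|R| + 2))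
  have hR := abs_nonneg R
  have hRl := mul_nonneg hl.le hR
  -- The bare seed has length `2 * lam`, too short to cover the window, so there is at least one
  -- inflation to strip.
  obtain _ | n := n
  · simp [tileLength] at h2
    nlinarith
  rw [Function.iterate_succ_apply'] at h h2
  obtain ⟨t, rfl⟩ : ∃ t, s = lam * t := ⟨s / lam, by field_simp⟩
  set u := subst^[n] [0, 0]
  rw [wordLength_subst] at h2
  have h1' : t ≤ -(|R| + 2) := by
    by_contra hc
    nlinarith
  have h2' : |R| + 2 < t + wordLength u := by
    by_contra hc
    nlinarith
  refine ⟨n, t, by linarith [le_abs_self R], by linarith [le_abs_self R], h, fun i x hx => ?_⟩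
  have hxR : |x| ≤ |R| := hx.trans (le_abs_self R)
  have e1 : |lam * x| ≤ lam * (|R| + 2) := by
    rw [abs_mul, abs_of_pos hl]; nlinarith
  have e2 : |lam * x + lam| ≤ lam * (|R| + 2) := by
    rw [show lam * x + lam = lam * (x + 1) by ring, abs_mul, abs_of_pos hl]
    have : |x + 1| ≤ |x| + 1 := by simpa using abs_add_le x 1
    nlinarith
  have z1 : ∀ y : ℝ, (lam * y - offset 0) / lam = y := fun y => by simp [offset, hl.ne']
  have z2 : lam * x + lam = lam * (x + 1) := by ring
  have k0 : lam * x ∈ B 0 ↔ x ∈ wordPoints 0 t u ∨ x ∈ wordPoints 1 t u := by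
    rw [h 0 _ e1, mem_wordPoints_subst]
    simp [parents, z1]
  have k0' : lam * x + lam ∈ B 0 ↔ x + 1 ∈ wordPoints 0 t u ∨ x + 1 ∈ wordPoints 1 t u := by
    rw [h 0 _ e2, mem_wordPoints_subst, z2]
    simp [parents, z1]
  have k1 : lam * x + lam ∈ B 1 ↔ x ∈ wordPoints 0 t u ∨ x - 1 / lam ∈ wordPoints 0 t u ∨
      x - 2 / lam ∈ wordPoints 0 t u := by
    rw [h 1 _ e2, mem_wordPoints_subst]
    have a0 : (lam * x + lam - (lam + ((0 : ℕ) : ℝ))) / lam = x := by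
      field_simp; push_cast; ring
    have a1 : (lam * x + lam - (lam + ((1 : ℕ) : ℝ))) / lam = x - 1 / lam := by
      field_simp; push_cast; ring
    have a2 : (lam * x + lam - (lam + ((2 : ℕ) : ℝ))) / lam = x - 2 / lam := by
      field_simp; push_cast; ring
    simp only [parents, Finset.mem_insert, Finset.mem_singleton, exists_eq_or_imp, exists_eq_left,
      offset, a0, a1, a2]
  have b1 : 0 < 1 / lam := by positivity
  have b2 : 2 / lam < 1 := by rw [div_lt_one hl]; linarith [lt_lam]
  have b3 : 1 / lam < 2 / lam := by gcongr; norm_num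
  have l0 : tileLength 0 = lam := rfl
  have l1 : tileLength 1 = 1 := rfl
  rcases fin_two_cases i with rfl | rfl
  · change lam * x ∈ B 0 ∧ lam * x + lam ∈ B 1 ↔ _
    rw [k0, k1]
    refine ⟨?_, fun hx => ⟨Or.inl hx, Or.inl hx⟩⟩
    -- The only conflicting cases have a `0` at `x - 1 / lam` or `x - 2 / lam` and a `1` at `x`,
    -- closer than the length `lam` of the tile `0`.
    rintro ⟨hx0 | hx1, h4 | h4 | h4⟩ <;> try assumption
    · have := add_le_of_mem_wordPoints h4 hx1 (by linarith)
      linarith [lt_lam]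
    · have := add_le_of_mem_wordPoints h4 hx1 (by linarith)
      linarith [lt_lam]
  · change lam * x ∈ B 0 ∧ lam * x + lam ∈ B 0 ↔ _
    rw [k0, k0']
    constructor
    · rintro ⟨hx0 | hx1, h4⟩
      · rcases h4 with h4 | h4
        · have := add_le_of_mem_wordPoints hx0 h4 (by linarith)
          linarith [lt_lam]
        · have := add_le_of_mem_wordPoints hx0 h4 (by linarith)
          linarith [lt_lam]
      · exact hx1
    · intro hx1
      refine ⟨Or.inr hx1, ?_⟩
      obtain ⟨j, hj⟩ := add_mem_wordPoints hx1 (by linarith [le_abs_self x])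
      rcases fin_two_cases j with rfl | rfl
      · exact Or.inl hj
      · exact Or.inr hj

lemma deflate (hB : IsLegal B) : IsLegal (deflate B) := fun R =>
  let ⟨n, t, h1, h2, _, h⟩ := hB.exists_deflate_window R
  ⟨n, t, h1, h2, h⟩

lemma mem_iff_deflate (hB : IsLegal B) {i : Fin 2} {x : ℝ} :
    x ∈ B i ↔ ∃ p ∈ parents i, (x - offset p.2) / lam ∈ InflationTiling.deflate B p.1 := by
  have hl := lam_pos
  obtain ⟨n, t, -, -, h, h'⟩ := hB.exists_deflate_window (|x| + 3)
  rw [h i x, mem_wordPoints_subst]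
  · refine exists_congr fun p => and_congr_right fun hp => (h' _ _ ?_).symm
    have h0 : |offset p.2| ≤ lam + 2 := by
      rw [abs_of_nonneg (offset_nonneg _)]
      exact offset_le hp
    rw [abs_div, abs_of_pos hl, div_le_iff₀ hl]
    nlinarith [abs_sub x (offset p.2), lt_lam, abs_nonneg x]
  · rw [abs_of_nonneg (by positivity : 0 ≤ |x| + 3)]
    nlinarith [lt_lam, abs_nonneg x]

/-- A point of an inflated pattern has only one parent. -/
lemma parent_unique (hB : IsLegal B) {i : Fin 2} {x : ℝ} {p q : Fin 2 × ℕ} (hp : p ∈ parents i)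
    (hq : q ∈ parents i) (hxp : (x - offset p.2) / lam ∈ B p.1)
    (hxq : (x - offset q.2) / lam ∈ B q.1) : p = q := by
  have hl := lam_pos
  wlog hpq : offset q.2 ≤ offset p.2 generalizing p q
  · exact (this hq hp hxq hxp (le_of_not_ge hpq)).symm
  rcases fin_two_cases i with rfl | rfl
  · simp only [parents, Finset.mem_insert, Finset.mem_singleton] at hp hq
    rcases hp with rfl | rfl <;> rcases hq with rfl | rfl <;> first
      | rfl
      | exact absurd (hB.type_unique hxp hxq) (by simp)
  · have h0 : ∀ r ∈ parents 1, r.1 = 0 ∧ lam ≤ offset r.2 ∧ offset r.2 ≤ lam + 2 ∧ 1 ≤ r.2 := by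
      intro r hr
      simp only [parents, Finset.mem_insert, Finset.mem_singleton] at hr
      rcases hr with rfl | rfl | rfl <;> simp [offset]
    obtain ⟨p1, -, p3, p4⟩ := h0 p hp
    obtain ⟨q1, q2, -, q4⟩ := h0 q hq
    have hle : (x - offset p.2) / lam ≤ (x - offset q.2) / lam := by gcongr
    have h2 : offset p.2 = offset q.2 := by
      -- Distinct parents of type `0` are at least `lam` apart, which forces the offsets to differ
      -- by `lam ^ 2`; they differ by at most `2`.
      rcases hle.lt_or_eq with h | h
      · have := hB.add_le hxp hxq h
        rw [p1, show tileLength 0 = lam from rfl, div_add' _ _ _ hl.ne', div_le_div_iff_of_pos_right hl]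
          at this
        nlinarith [lam_sq, lam_pos]
      · rw [div_left_inj' hl.ne'] at h
        linarith
    refine Prod.ext (p1.trans q1.symm) ?_
    obtain ⟨a, ha⟩ := Nat.exists_eq_add_of_le' p4
    obtain ⟨b, hb⟩ := Nat.exists_eq_add_of_le' q4
    rw [ha, hb] at h2 ⊢
    simpa [offset] using h2

end IsLegal

/-! ### From the fixed point to the hull -/

lemma iterate_subst_append (n : ℕ) (u v : List (Fin 2)) :
    subst^[n] (u ++ v) = subst^[n] u ++ subst^[n] v := by
  induction n generalizing u v with
  | zero => rfl
  | succ n ih => rw [Function.iterate_succ_apply, subst_append, ih]; rfl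

lemma superWord_eq (n : ℕ) : superWord n = subst^[2 * n] [0] := by
  rw [superWord, Function.iterate_mul]; rfl

lemma superWord_succ (n : ℕ) : ∃ v, superWord (n + 1) = superWord n ++ v ++ superWord n := by
  refine ⟨subst^[2 * n] [1, 1, 1, 0, 0], ?_⟩
  rw [superWord_eq, superWord_eq, ← iterate_subst_append, ← iterate_subst_append, mul_add,
    Function.iterate_add_apply]
  rfl

lemma lt_length_superWord (n : ℕ) : n < (superWord n).length := by
  induction n with
  | zero => simp [superWord]
  | succ n ih =>
    obtain ⟨v, hv⟩ := superWord_succ n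
    simp only [hv, List.length_append]
    omega

lemma superWord_prefix {m n : ℕ} (h : m ≤ n) : superWord m <+: superWord n := by
  induction n, h using Nat.le_induction with
  | base => exact List.prefix_rfl
  | succ n _ ih =>
    obtain ⟨v, hv⟩ := superWord_succ n
    rw [hv, List.append_assoc]
    exact ih.trans (List.prefix_append _ _)

lemma superWord_suffix {m n : ℕ} (h : m ≤ n) : superWord m <:+ superWord n := by
  induction n, h using Nat.le_induction with
  | base => exact List.suffix_rfl
  | succ n _ ih =>
    obtain ⟨v, hv⟩ := superWord_succ n
    rw [hv]
    exact ih.trans (List.suffix_append _ _)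

lemma getD_of_prefix {α : Type*} {u v : List α} (h : u <+: v) {k : ℕ} (hk : k < u.length) (d : α) :
    v.getD k d = u.getD k d := by
  obtain ⟨w, rfl⟩ := h
  exact List.getD_append _ _ _ _ hk

lemma fixedPoint_natCast {n k : ℕ} (hk : k < (superWord n).length) :
    fixedPoint (k : ℤ) = (superWord n).getD k 0 := by
  change (superWord k).getD k 0 = _
  rcases le_total k n with h | h
  · exact (getD_of_prefix (superWord_prefix h) (lt_length_superWord k) 0).symm
  · exact getD_of_prefix (superWord_prefix h) hk 0

lemma fixedPoint_negSucc {n k : ℕ} (hk : k < (superWord n).length) :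
    fixedPoint (Int.negSucc k) = (superWord n).reverse.getD k 0 := by
  change (superWord k).reverse.getD k 0 = _
  rcases le_total k n with h | h
  · exact (getD_of_prefix (List.reverse_prefix.2 (superWord_suffix h))
      (by simpa using lt_length_superWord k) 0).symm
  · exact getD_of_prefix (List.reverse_prefix.2 (superWord_suffix h)) (by simpa using hk) 0

lemma fixedPoint_window {n k : ℕ} (hk : k < (superWord n ++ superWord n).length) :
    fixedPoint (-((superWord n).length : ℤ) + k) = (superWord n ++ superWord n).getD k 0 := by
  set N := (superWord n).length with hN
  rw [List.length_append] at hk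
  rcases lt_or_ge k N with h | h
  · have h1 : -(N : ℤ) + k = Int.negSucc (N - 1 - k) := by
      rw [Int.negSucc_eq]; omega
    rw [h1, fixedPoint_negSucc (n := n) (by omega), List.getD_append _ _ _ _ (by omega)]
    rw [List.getD_eq_getElem _ _ (by rw [List.length_reverse]; omega),
      List.getD_eq_getElem _ _ (by omega), List.getElem_reverse]
    congr 1
    omega
  · have h1 : -(N : ℤ) + k = ((k - N : ℕ) : ℤ) := by omega
    rw [h1, fixedPoint_natCast (n := n) (by omega), List.getD_append_right _ _ _ _ (by omega)]

lemma leftEndpoint_succ (m : ℤ) :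
    leftEndpoint (m + 1) = leftEndpoint m + tileLength (fixedPoint m) := by
  unfold leftEndpoint
  rcases le_or_gt 0 m with h | h
  · have h1 : Finset.Ico 0 (m + 1) = insert m (Finset.Ico 0 m) := by
      ext x; simp only [Finset.mem_Ico, Finset.mem_insert]; omega
    rw [h1, Finset.sum_insert (by simp), Finset.Ico_eq_empty (by omega : ¬ m + 1 < 0),
      Finset.Ico_eq_empty (by omega : ¬ m < 0)]
    ring
  · have h1 : Finset.Ico m 0 = insert m (Finset.Ico (m + 1) 0) := by
      ext x; simp only [Finset.mem_Ico, Finset.mem_insert]; omega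
    rw [h1, Finset.sum_insert (by simp), Finset.Ico_eq_empty (by omega : ¬ 0 < m + 1),
      Finset.Ico_eq_empty (by omega : ¬ 0 < m)]
    ring

lemma leftEndpoint_strictMono : StrictMono leftEndpoint :=
  strictMono_int_of_lt_succ fun m => by
    rw [leftEndpoint_succ]; linarith [one_le_tileLength (fixedPoint m)]

lemma mem_wordPoints_leftEndpoint {i : Fin 2} {x : ℝ} {u : List (Fin 2)} {m : ℤ}
    (h : ∀ k < u.length, fixedPoint (m + k) = u.getD k 0) :
    x ∈ wordPoints i (leftEndpoint m) u ↔
      ∃ k < u.length, leftEndpoint (m + (k : ℕ)) = x ∧ fixedPoint (m + (k : ℕ)) = i := by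
  induction u generalizing m with
  | nil => simp
  | cons a u ih =>
    have h0 : fixedPoint m = a := by simpa using h 0 (by simp)
    have ih' : x ∈ wordPoints i (leftEndpoint (m + 1)) u ↔ ∃ k < u.length,
        leftEndpoint (m + 1 + (k : ℕ)) = x ∧ fixedPoint (m + 1 + (k : ℕ)) = i := by
      refine ih fun k hk => ?_
      have := h (k + 1) (by simpa using hk)
      rw [List.getD_cons_succ] at this
      rw [← this]
      push_cast
      congr 1
      ring
    rw [mem_wordPoints_cons, ← h0, ← leftEndpoint_succ, ih']
    constructor
    · rintro (⟨rfl, h1⟩ | ⟨k, hk, h1⟩)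
      · exact ⟨0, by simp, by simpa using h1⟩
      · refine ⟨k + 1, by simpa using hk, ?_⟩
        rw [show m + ((k + 1 : ℕ) : ℤ) = m + 1 + k by push_cast; ring]
        exact h1
    · rintro ⟨_ | k, hk, h1⟩
      · left
        simp only [Nat.cast_zero, add_zero] at h1
        exact ⟨h1.1.symm, h1.2⟩
      · right
        refine ⟨k, by simpa using hk, ?_⟩
        rw [show m + ((k + 1 : ℕ) : ℤ) = m + 1 + k by push_cast; ring] at h1
        exact h1

lemma leftEndpoint_add_length {u : List (Fin 2)} {m : ℤ}
    (h : ∀ k < u.length, fixedPoint (m + k) = u.getD k 0) :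
    leftEndpoint (m + u.length) = leftEndpoint m + wordLength u := by
  induction u generalizing m with
  | nil => simp
  | cons a u ih =>
    have h0 : fixedPoint m = a := by simpa using h 0 (by simp)
    have ih' : leftEndpoint (m + 1 + u.length) = leftEndpoint (m + 1) + wordLength u := by
      refine ih fun k hk => ?_
      have := h (k + 1) (by simpa using hk)
      rw [List.getD_cons_succ] at this
      rw [← this]
      push_cast
      congr 1
      ring
    rw [leftEndpoint_succ, h0] at ih'
    rw [List.length_cons, wordLength_cons, ← add_assoc, ← ih']
    push_cast
    congr 1
    ring

lemma length_le_wordLength (u : List (Fin 2)) : (u.length : ℝ) ≤ wordLength u := by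
  induction u with
  | nil => simp
  | cons a u ih =>
    rw [wordLength_cons, List.length_cons]
    push_cast
    linarith [one_le_tileLength a]

lemma mem_fixedPointSet_iff (n : ℕ) {x : ℝ} (hx : |x| < wordLength (superWord n)) :
    x ∈ fixedPointSet ↔
      ∃ i, x ∈ wordPoints i (-wordLength (superWord n)) (superWord n ++ superWord n) := by
  set N := (superWord n).length with hN
  have h1 : ∀ k < (superWord n ++ superWord n).length,
      fixedPoint (-(N : ℤ) + k) = (superWord n ++ superWord n).getD k 0 :=
    fun k hk => fixedPoint_window hk
  have hz : leftEndpoint 0 = 0 := by simp [leftEndpoint]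
  have h2 : leftEndpoint N = wordLength (superWord n) := by
    have := leftEndpoint_add_length (u := superWord n) (m := 0) fun k hk => by
      rw [zero_add]; exact fixedPoint_natCast hk
    rwa [zero_add, hz, zero_add] at this
  have h3 : leftEndpoint (-(N : ℤ)) = -wordLength (superWord n) := by
    have := leftEndpoint_add_length h1
    rw [List.length_append, ← hN, wordLength_append,
      show -(N : ℤ) + ((N + N : ℕ) : ℤ) = N by push_cast; ring, h2] at this
    linarith
  rw [← h3]
  simp only [mem_wordPoints_leftEndpoint h1]
  rw [abs_lt, ← h3, ← h2] at hx
  constructor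
  · rintro ⟨m, rfl⟩
    have h4 := leftEndpoint_strictMono.lt_iff_lt.1 hx.1
    have h5 := leftEndpoint_strictMono.lt_iff_lt.1 hx.2
    refine ⟨_, (m + N).toNat, ?_, ?_, rfl⟩
    · rw [List.length_append]; omega
    · congr 1; omega
  · rintro ⟨i, k, -, rfl, -⟩
    exact ⟨_, rfl⟩

lemma mem_translate {t x : ℝ} {A : Set ℝ} : x ∈ translate t A ↔ x - t ∈ A := by
  constructor
  · rintro ⟨y, hy, rfl⟩
    simpa using hy
  · intro h
    exact ⟨x - t, h, by simp⟩

/-- Around the marker the fixed point reads `superWord n ++ superWord n`, an inflation of the seed.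
The choice `ε = 1 / (|R| + 1)` makes the window of agreement contain `[-R, R]`, and both
translations are absorbed into `s`. -/
lemma hull_window {A : Set ℝ} (hA : A ∈ hull) (R : ℝ) : ∃ (n : ℕ) (s : ℝ), s ≤ -R ∧
    R < s + wordLength (subst^[n] [0, 0]) ∧
    ∀ x, |x| ≤ R → (x ∈ A ↔ ∃ i, x ∈ wordPoints i s (subst^[n] [0, 0])) := by
  obtain ⟨t, t', -, h⟩ := hA (1 / (|R| + 1)) (by positivity)
  rw [one_div_one_div] at h
  obtain ⟨n, hn⟩ := exists_nat_gt (|R| + |t| + |t'|)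
  have hL : |R| + |t| + |t'| < wordLength (superWord n) := by
    have h1 : (n : ℝ) < (superWord n).length := by exact_mod_cast lt_length_superWord n
    linarith [length_le_wordLength (superWord n)]
  have e : subst^[2 * n] [0, 0] = superWord n ++ superWord n := by
    rw [superWord_eq, ← iterate_subst_append]; rfl
  refine ⟨2 * n, -wordLength (superWord n) + (t + t'), ?_, ?_, fun x hx => ?_⟩
  · linarith [le_abs_self R, le_abs_self t, le_abs_self t']
  · rw [e, wordLength_append]
    linarith [le_abs_self R, neg_abs_le t, neg_abs_le t']
  · have h1 : x ∈ A ↔ x - t' - t ∈ fixedPointSet := by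
      have hI : x ∈ Set.Icc (-(|R| + 1)) (|R| + 1) := by
        rw [abs_le] at hx
        constructor <;> linarith [le_abs_self R]
      have := Set.ext_iff.1 h x
      rw [Set.mem_inter_iff, Set.mem_inter_iff, mem_translate, mem_translate] at this
      tauto
    rw [h1, e, mem_fixedPointSet_iff n]
    · simp only [wordPoints_shift, sub_sub, add_comm t]
    · have := abs_sub (x - t') t
      have := abs_sub x t'
      linarith [le_abs_self R]

lemma hull_typed_window {A : Set ℝ} (hA : A ∈ hull) (R : ℝ) : ∃ (n : ℕ) (s : ℝ), s ≤ -R ∧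
    R < s + wordLength (subst^[n] [0, 0]) ∧
    (∀ x, |x| ≤ R → (x ∈ A ↔ ∃ i, x ∈ wordPoints i s (subst^[n] [0, 0]))) ∧
    ∀ i x, |x| ≤ R → (x ∈ pointsOfType A i ↔ x ∈ wordPoints i s (subst^[n] [0, 0])) := by
  -- A type is read off from the distance to the right neighbour; the margin `lam` keeps that
  -- neighbour inside the window.
  obtain ⟨n, s, h1, h2, h⟩ := hull_window hA (R + lam)
  have hl := lam_pos
  set u := subst^[n] [0, 0]
  refine ⟨n, s, by linarith, by linarith, fun x hx => h x (by linarith), fun i x hx => ?_⟩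
  have hxR := abs_le.1 hx
  have hin : ∀ y, x ≤ y → y ≤ x + lam → (y ∈ A ↔ ∃ i, y ∈ wordPoints i s u) := fun y h3 h4 =>
    h y (abs_le.2 ⟨by linarith, by linarith⟩)
  have hnext : ∀ j, x ∈ wordPoints j s u → x + tileLength j ∈ A := fun j hj =>
    (hin _ (by linarith [one_le_tileLength j]) (by linarith [tileLength_le j])).2
      (add_mem_wordPoints hj (by linarith [tileLength_le j]))
  have hempty : ∀ j, x ∈ wordPoints j s u → A ∩ Set.Ioo x (x + tileLength j) = ∅ := by
    intro j hj
    rw [Set.eq_empty_iff_forall_notMem]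
    rintro y ⟨hy, h3, h4⟩
    obtain ⟨k, hk⟩ := (hin y h3.le (by linarith [tileLength_le j])).1 hy
    linarith [add_le_of_mem_wordPoints hj hk h3]
  constructor
  · rintro ⟨h3, h4, h5⟩
    obtain ⟨j, hj⟩ := (hin x le_rfl (by linarith)).1 h3
    rcases lt_trichotomy (tileLength i) (tileLength j) with h6 | h6 | h6
    · have : x + tileLength i ∈ A ∩ Set.Ioo x (x + tileLength j) :=
        ⟨h4, by linarith [one_le_tileLength i], by linarith⟩
      rw [hempty j hj] at this
      exact this.elim
    · have : i = j := by
        rcases fin_two_cases i with rfl | rfl <;> rcases fin_two_cases j with rfl | rfl <;>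
          first
          | rfl
          | (simp only [tileLength] at h6; linarith [lt_lam])
      rwa [this]
    · have : x + tileLength j ∈ A ∩ Set.Ioo x (x + tileLength i) :=
        ⟨hnext j hj, by linarith [one_le_tileLength j], by linarith⟩
      rw [h5] at this
      exact this.elim
  · intro hi
    exact ⟨(hin x le_rfl (by linarith)).2 ⟨i, hi⟩, hnext i hi, hempty i hi⟩

lemma isLegal_pointsOfType {A : Set ℝ} (hA : A ∈ hull) : IsLegal (pointsOfType A) := fun R =>
  let ⟨n, s, h1, h2, _, h⟩ := hull_typed_window hA R
  ⟨n, s, h1, h2, h⟩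

lemma mem_iff_exists_pointsOfType {A : Set ℝ} (hA : A ∈ hull) {x : ℝ} :
    x ∈ A ↔ ∃ i, x ∈ pointsOfType A i := by
  obtain ⟨n, s, -, -, h, h'⟩ := hull_typed_window hA |x|
  rw [h x le_rfl]
  exact exists_congr fun i => (h' i x le_rfl).symm

/-! ### Pair densities and their exact recursion -/

/-- The points of type `i` in `[-r, r]` that have a point of type `j` at distance `z`. -/
def pairSet (B : Fin 2 → Set ℝ) (i j : Fin 2) (z r : ℝ) : Set ℝ :=
  {x | x ∈ B i ∧ x + z ∈ B j ∧ |x| ≤ r}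

/-- The number of pairs per length in a window. -/
noncomputable def density (i j : Fin 2) (z : ℝ) (p : ℝ × (Fin 2 → Set ℝ)) : ℝ :=
  (pairSet p.2 i j z p.1).ncard / (2 * p.1)

/-- Growing windows, uniformly in all legal patterns. -/
def legalFilter : Filter (ℝ × (Fin 2 → Set ℝ)) := atTop ×ˢ 𝓟 {B | IsLegal B}

lemma eventually_isLegal : ∀ᶠ p in legalFilter, IsLegal p.2 :=
  Eventually.prod_inr (eventually_principal.2 fun _ h => h) _

lemma eventually_ge (R : ℝ) : ∀ᶠ p in legalFilter, R ≤ p.1 :=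
  Eventually.prod_inl (eventually_ge_atTop R) _

lemma tendsto_deflate (c : ℝ) :
    Tendsto (fun p : ℝ × (Fin 2 → Set ℝ) => (p.1 / lam, shift c (deflate p.2)))
      legalFilter legalFilter := by
  refine Tendsto.prodMk (tendsto_fst.atTop_div_const lam_pos) (tendsto_principal.2 ?_)
  exact eventually_isLegal.mono fun p hp => hp.deflate.shift c

lemma tendsto_shift (c : ℝ) :
    Tendsto (fun p : ℝ × (Fin 2 → Set ℝ) => (p.1, shift c p.2)) legalFilter legalFilter := by
  refine Tendsto.prodMk tendsto_fst (tendsto_principal.2 ?_)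
  exact eventually_isLegal.mono fun p hp => hp.shift c

lemma tendsto_of_isLegal {B : Fin 2 → Set ℝ} (hB : IsLegal B) :
    Tendsto (fun r : ℝ => (r, B)) atTop legalFilter :=
  tendsto_id.prodMk (tendsto_principal.2 (Eventually.of_forall fun _ => hB))

lemma finite_pairSet {B : Fin 2 → Set ℝ} (hB : IsLegal B) (i j : Fin 2) (z r : ℝ) :
    (pairSet B i j z r).Finite :=
  (hB.finite_window i r).subset fun _ hx => ⟨hx.1, hx.2.2⟩

lemma mem_pairSet_iff {B : Fin 2 → Set ℝ} (hB : IsLegal B) {i j : Fin 2} {z r x : ℝ} :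
    x ∈ pairSet B i j z r ↔ ∃ p ∈ parents i, ∃ q ∈ parents j,
      x / lam ∈ pairSet (shift (offset p.2 / lam) (deflate B)) p.1 q.1
        ((z + offset p.2 - offset q.2) / lam) (r / lam) := by
  have hl := lam_pos
  have e : ∀ p q : Fin 2 × ℕ, x / lam + (z + offset p.2 - offset q.2) / lam - offset p.2 / lam
      = (x + z - offset q.2) / lam := fun p q => by ring
  simp only [pairSet, shift, Set.mem_ofPred_eq, hB.mem_iff_deflate (i := i), e, ← sub_div,
    hB.mem_iff_deflate (i := j), abs_div, abs_of_pos hl, div_le_div_iff_of_pos_right hl]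
  grind

/-- Unique parents split the pairs into disjoint classes, and scaling by `lam` identifies each class
with a set of pairs of parents. Shifting the deflated pattern by `offset p.2 / lam` keeps the window
centred, so there is no boundary error. -/
lemma ncard_pairSet {B : Fin 2 → Set ℝ} (hB : IsLegal B) (i j : Fin 2) (z r : ℝ) :
    (pairSet B i j z r).ncard = ∑ p ∈ parents i, ∑ q ∈ parents j,
      (pairSet (shift (offset p.2 / lam) (deflate B)) p.1 q.1
        ((z + offset p.2 - offset q.2) / lam) (r / lam)).ncard := by
  classical
  have hl := lam_pos
  have hl' := hl.ne'
  rw [← Finset.sum_product']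
  have hf : ∀ t : (Fin 2 × ℕ) × (Fin 2 × ℕ), (pairSet (shift (offset t.1.2 / lam) (deflate B)) t.1.1
      t.2.1 ((z + offset t.1.2 - offset t.2.2) / lam) (r / lam)).Finite :=
    fun t => finite_pairSet (hB.deflate.shift _) _ _ _ _
  have h1 : (pairSet B i j z r) = ↑((parents i ×ˢ parents j).biUnion
      fun t => (hf t).toFinset.image (fun y => lam * y)) := by
    ext x
    rw [mem_pairSet_iff hB]
    simp only [Finset.coe_biUnion, Finset.coe_image, Set.Finite.coe_toFinset, Set.mem_iUnion,
      Set.mem_image, Finset.mem_coe, Finset.mem_product, exists_prop, Prod.exists]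
    have : ∀ S : Set ℝ, (∃ y ∈ S, lam * y = x) ↔ x / lam ∈ S := fun S => by
      constructor
      · rintro ⟨y, hy, rfl⟩
        rwa [mul_div_cancel_left₀ _ hl']
      · intro h
        exact ⟨_, h, mul_div_cancel₀ _ hl'⟩
    simp only [this]
    grind
  rw [h1, Set.ncard_coe_finset, Finset.card_biUnion]
  · refine Finset.sum_congr rfl fun t _ => ?_
    rw [Finset.card_image_of_injective _ (mul_right_injective₀ hl'),
      Set.ncard_eq_toFinset_card _ (hf t)]
  · intro t ht t' ht' hne
    rw [Function.onFun, Finset.disjoint_left]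
    intro x hx hx'
    apply hne
    simp only [Finset.mem_image, Set.Finite.mem_toFinset] at hx hx'
    obtain ⟨y, hy, rfl⟩ := hx
    obtain ⟨y', hy', h⟩ := hx'
    obtain rfl := mul_right_injective₀ hl' h
    rw [Finset.mem_coe, Finset.mem_product] at ht ht'
    have a : ∀ p : Fin 2 × ℕ, y' - offset p.2 / lam = (lam * y' - offset p.2) / lam := fun p => by
      field_simp
    have b : ∀ p q : Fin 2 × ℕ, y' + (z + offset p.2 - offset q.2) / lam - offset p.2 / lam
      = (lam * y' + z - offset q.2) / lam := fun p q => by field_simp; ring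
    simp only [pairSet, shift, Set.mem_ofPred_eq, a, b] at hy hy'
    exact Prod.ext (hB.deflate.parent_unique ht.1 ht'.1 hy.1 hy'.1)
      (hB.deflate.parent_unique ht.2 ht'.2 hy.2.1 hy'.2.1)

lemma density_eq {B : Fin 2 → Set ℝ} (hB : IsLegal B) (i j : Fin 2) (z r : ℝ) :
    density i j z (r, B) = 1 / lam * ∑ p ∈ parents i, ∑ q ∈ parents j,
      density p.1 q.1 ((z + offset p.2 - offset q.2) / lam)
        (r / lam, shift (offset p.2 / lam) (deflate B)) := by
  have hl := lam_pos.ne'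
  simp only [density, ncard_pairSet hB i j z r]
  push_cast
  simp only [← Finset.sum_div]
  rcases eq_or_ne r 0 with rfl | hr
  · simp
  · field_simp

lemma density_nonneg {i j : Fin 2} {z : ℝ} {p : ℝ × (Fin 2 → Set ℝ)} (hp : 0 ≤ p.1) :
    0 ≤ density i j z p := by
  unfold density; positivity

/-- Each pair is counted from its other end; the pattern is moved by `z` so that the window can stay
in place. -/
lemma density_neg (i j : Fin 2) (z r : ℝ) (B : Fin 2 → Set ℝ) :
    density i j (-z) (r, B) = density j i z (r, shift z B) := by
  have : pairSet B i j (-z) r = pairSet (shift z B) j i z r := by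
    ext x
    simp only [pairSet, shift, Set.mem_ofPred_eq, add_sub_cancel_right, ← sub_eq_add_neg]
    tauto
  simp only [density, this]

/-- The tiles starting in `[-r, r]` are disjoint, cover `[-r + lam, r)` and stay inside `[-r, r +
lam)`. -/
lemma abs_length_sub_le {B : Fin 2 → Set ℝ} (hB : IsLegal B) {r : ℝ} (hr : lam ≤ r) :
    |lam * (pairSet B 0 0 0 r).ncard + (pairSet B 1 1 0 r).ncard - 2 * r| ≤ lam := by
  have hl := lam_pos
  have hf : ∀ i, (pairSet B i i 0 r).Finite := fun i => finite_pairSet hB i i 0 r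
  have hdisj : (↑((Finset.univ : Finset (Fin 2)).sigma fun i => (hf i).toFinset) :
      Set ((_ : Fin 2) × ℝ)).PairwiseDisjoint fun p => Set.Ico p.2 (p.2 + tileLength p.1) := by
    rintro ⟨i, x⟩ hx ⟨j, y⟩ hy hne
    simp only [Finset.coe_sigma, Set.mem_sigma_iff, Finset.mem_coe, Set.Finite.mem_toFinset] at hx hy
    change Disjoint (Set.Ico x (x + tileLength i)) (Set.Ico y (y + tileLength j))
    rw [Set.disjoint_left]
    rintro v ⟨h1, h2⟩ ⟨h3, h4⟩
    rcases lt_trichotomy x y with h | rfl | h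
    · linarith [hB.add_le hx.2.1 hy.2.1 h]
    · obtain rfl := hB.type_unique hx.2.1 hy.2.1
      exact hne rfl
    · linarith [hB.add_le hy.2.1 hx.2.1 h]
  have hsum := MeasureTheory.measureReal_biUnion_finset (μ := MeasureTheory.volume) hdisj
    (fun p _ => measurableSet_Ico) (fun p _ => by simp)
  have hv : lam * (pairSet B 0 0 0 r).ncard + (pairSet B 1 1 0 r).ncard =
      MeasureTheory.volume.real (⋃ p ∈ (Finset.univ : Finset (Fin 2)).sigma
        fun i => (hf i).toFinset, Set.Ico p.2 (p.2 + tileLength p.1)) := by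
    rw [hsum, Finset.sum_sigma, Fin.sum_univ_two]
    have h0 : ∀ i, 0 ≤ tileLength i := fun i => by linarith [one_le_tileLength i]
    simp only [Real.volume_real_Ico, add_sub_cancel_left, max_eq_left (h0 _), Finset.sum_const,
      nsmul_eq_mul, Set.ncard_eq_toFinset_card _ (hf 0), Set.ncard_eq_toFinset_card _ (hf 1)]
    simp only [tileLength]
    ring
  rw [hv]
  set S := ⋃ p ∈ (Finset.univ : Finset (Fin 2)).sigma
        fun i => (hf i).toFinset, Set.Ico p.2 (p.2 + tileLength p.1) with hS
  have hsub : S ⊆ Set.Ico (-r) (r + lam) := by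
    intro v hv
    simp only [hS, Set.mem_iUnion, Finset.mem_sigma, Set.Finite.mem_toFinset] at hv
    obtain ⟨⟨i, x⟩, ⟨-, hx⟩, h1, h2⟩ := hv
    have := abs_le.1 hx.2.2
    simp only at h1 h2 this
    constructor <;> linarith [tileLength_le i]
  have hsup : Set.Ico (-r + lam) r ⊆ S := by
    rintro v ⟨h1, h2⟩
    obtain ⟨i, x, hx, h3, h4⟩ := hB.exists_mem v
    simp only [hS, Set.mem_iUnion, Finset.mem_sigma, Set.Finite.mem_toFinset]
    refine ⟨⟨i, x⟩, ⟨Finset.mem_univ _, hx, by simpa using hx, abs_le.2 ⟨?_, ?_⟩⟩, h3, h4⟩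
    · simp only; linarith [tileLength_le i]
    · simp only; linarith
  have hfin : MeasureTheory.volume S ≠ ⊤ :=
    ((MeasureTheory.measure_mono hsub).trans_lt (by simp)).ne
  have e1 := MeasureTheory.measureReal_mono (μ := MeasureTheory.volume) hsub (by simp)
  have e2 := MeasureTheory.measureReal_mono (μ := MeasureTheory.volume) hsup hfin
  rw [Real.volume_real_Ico_of_le (by linarith)] at e1 e2
  rw [abs_le]
  constructor <;> linarith

/-! ### Occurring differences and induction along the inflation -/

/-- The difference `z` occurs, from a point of type `i` to a point of type `j`, in some legal
pattern. -/
def Occurs (i j : Fin 2) (z : ℝ) : Prop := ∃ B, IsLegal B ∧ ∃ x ∈ B i, x + z ∈ B j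

namespace Occurs

variable {i j : Fin 2} {z : ℝ}

lemma symm (h : Occurs i j z) : Occurs j i (-z) := by
  obtain ⟨B, hB, x, hx, hy⟩ := h
  exact ⟨B, hB, x + z, hy, by simpa using hx⟩

lemma exists_nat (h : Occurs i j z) (hz : 0 ≤ z) : ∃ a b : ℕ, z = a * lam + b := by
  obtain ⟨B, hB, x, hx, hy⟩ := h
  simpa using hB.exists_sub_of_le hx hy (by linarith)

lemma tileLength_le (h : Occurs i j z) (hz : 0 < z) : tileLength i ≤ z := by
  obtain ⟨B, hB, x, hx, hy⟩ := h
  linarith [hB.add_le hx hy (by linarith)]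

lemma eq_of_zero (h : Occurs i j 0) : i = j := by
  obtain ⟨B, hB, x, hx, hy⟩ := h
  exact hB.type_unique hx (by simpa using hy)

lemma exists_parents (h : Occurs i j z) : ∃ p ∈ parents i, ∃ q ∈ parents j,
    Occurs p.1 q.1 ((z + offset p.2 - offset q.2) / lam) := by
  obtain ⟨B, hB, x, hx, hy⟩ := h
  obtain ⟨p, hp, hx⟩ := hB.mem_iff_deflate.1 hx
  obtain ⟨q, hq, hy⟩ := hB.mem_iff_deflate.1 hy
  refine ⟨p, hp, q, hq, deflate B, hB.deflate, _, hx, ?_⟩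
  rwa [← add_div, show x - offset p.2 + (z + offset p.2 - offset q.2) = x + z - offset q.2 by ring]

lemma eq_of_lt_four (h : Occurs i j z) (hz : 0 ≤ z) (hz' : z < 4) :
    z = 0 ∨ z = 1 ∨ z = 2 ∨ z = 3 ∨ z = lam ∨ z = lam + 1 := by
  obtain ⟨a, b, rfl⟩ := h.exists_nat hz
  have hl := lt_lam
  have ha : a < 2 := by
    by_contra! hc
    have : (2 : ℝ) ≤ a := by exact_mod_cast hc
    nlinarith [(Nat.cast_nonneg b : (0 : ℝ) ≤ b)]
  have hb : b < 4 := by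
    have : (b : ℝ) < 4 := by nlinarith [(Nat.cast_nonneg a : (0 : ℝ) ≤ a)]
    exact_mod_cast this
  interval_cases a <;> interval_cases b <;> norm_num at hz' ⊢ <;> linarith

end Occurs

section Induction

variable {P : Fin 2 → Fin 2 → ℝ → Prop}

/-- The properties of a predicate on pairs of types and differences that allow to derive it for all
differences along the inflation. -/
structure InflationInductive (P : Fin 2 → Fin 2 → ℝ → Prop) : Prop where
  of_not_occurs : ∀ i j z, ¬ Occurs i j z → P i j z
  symm : ∀ i j z, P i j z → P j i (-z)
  step : ∀ i j z, (∀ p ∈ parents i, ∀ q ∈ parents j,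
    P p.1 q.1 ((z + offset p.2 - offset q.2) / lam)) → P i j z

namespace InflationInductive

/-- The excluded values are `lam` times the possible differences `1`, `2`, `3`, `lam`, `lam + 1`,
rewritten with `lam ^ 2 = lam + 3`. -/
lemma gap (h : InflationInductive P) (i j : Fin 2) {w : ℝ} (h0 : 0 < w) (h4 : w < 4 * lam) (h1 : w ≠ lam)
    (h2 : w ≠ 2 * lam) (h3 : w ≠ lam + 3) (h5 : w ≠ 3 * lam) (h6 : w ≠ 2 * lam + 3) :
    P i j (w / lam) := by
  refine h.of_not_occurs i j _ fun ho => ?_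
  have hl := lam_pos
  have := ho.eq_of_lt_four (by positivity) ((div_lt_iff₀ hl).2 h4)
  simp only [div_eq_iff hl.ne'] at this
  rcases this with h | h | h | h | h | h
  · linarith
  · exact h1 (by linarith)
  · exact h2 h
  · exact h5 h
  · exact h3 (by linarith [lam_sq])
  · exact h6 (by linarith [lam_sq])

/-- A positive difference starting from a point of type `0` is at least `lam`, and `lam * lam = lam
+ 3`. -/
lemma short (h : InflationInductive P) (j : Fin 2) {w : ℝ} (h0 : 0 < w) (h1 : w < lam + 3) :
    P 0 j (w / lam) := by
  refine h.of_not_occurs 0 j _ fun ho => ?_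
  have hl := lam_pos
  have := ho.tileLength_le (by positivity)
  rw [show tileLength 0 = lam from rfl, le_div_iff₀ hl] at this
  linarith [lam_sq]

lemma short_neg (h : InflationInductive P) (i : Fin 2) {w : ℝ} (h0 : w < 0) (h1 : -(lam + 3) < w) :
    P i 0 (w / lam) := by
  have := h.symm _ _ _ (h.short i (w := -w) (by linarith) (by linarith))
  rwa [neg_div, neg_neg] at this

lemma step_zero_zero (h : InflationInductive P) {z : ℝ} (hz : ∀ i j, P i j (z / lam)) : P 0 0 z := by
  refine h.step 0 0 z fun p hp q hq => ?_
  have : offset p.2 = 0 ∧ offset q.2 = 0 := by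
    simp only [parents, Finset.mem_insert, Finset.mem_singleton] at hp hq
    rcases hp with rfl | rfl <;> rcases hq with rfl | rfl <;> exact ⟨rfl, rfl⟩
  rw [this.1, this.2, add_zero, sub_zero]
  exact hz _ _

lemma step_zero_one (h : InflationInductive P) {z : ℝ} (h0 : ∀ i, P i 0 ((z - lam) / lam))
    (h1 : ∀ i, P i 0 ((z - lam - 1) / lam)) (h2 : ∀ i, P i 0 ((z - lam - 2) / lam)) :
    P 0 1 z := by
  refine h.step 0 1 z fun p hp q hq => ?_
  have : offset p.2 = 0 := by
    simp only [parents, Finset.mem_insert, Finset.mem_singleton] at hp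
    rcases hp with rfl | rfl <;> rfl
  rw [this, add_zero]
  simp only [parents, Finset.mem_insert, Finset.mem_singleton] at hq
  rcases hq with rfl | rfl | rfl <;> simp only [offset, ← sub_sub]
  · simpa using h0 p.1
  · simpa using h1 p.1
  · simpa using h2 p.1

lemma step_one_zero (h : InflationInductive P) {z : ℝ} (h0 : ∀ i, P 0 i ((z + lam) / lam))
    (h1 : ∀ i, P 0 i ((z + lam + 1) / lam)) (h2 : ∀ i, P 0 i ((z + lam + 2) / lam)) :
    P 1 0 z := by
  rw [← neg_neg z]
  refine h.symm _ _ _ (h.step_zero_one (fun i => ?_) (fun i => ?_) fun i => ?_)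
  · convert h.symm _ _ _ (h0 i) using 1; ring
  · convert h.symm _ _ _ (h1 i) using 1; ring
  · convert h.symm _ _ _ (h2 i) using 1; ring

lemma step_one_one (h : InflationInductive P) {z : ℝ} (h0 : P 0 0 ((z - 2) / lam))
    (h1 : P 0 0 ((z - 1) / lam)) (h2 : P 0 0 (z / lam)) (h3 : P 0 0 ((z + 1) / lam))
    (h4 : P 0 0 ((z + 2) / lam)) : P 1 1 z := by
  refine h.step 1 1 z fun p hp q hq => ?_
  simp only [parents, Finset.mem_insert, Finset.mem_singleton] at hp hq
  rcases hp with rfl | rfl | rfl <;> rcases hq with rfl | rfl | rfl <;>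
    simp only [offset, Nat.cast_zero, Nat.cast_one, Nat.cast_ofNat] <;>
    first
    | (convert h0 using 2; ring; done)
    | (convert h1 using 2; ring; done)
    | (convert h2 using 2; ring; done)
    | (convert h3 using 2; ring; done)
    | (convert h4 using 2; ring)

lemma one_one_one (h : InflationInductive P) (h00 : P 0 0 0) : P 1 1 1 := by
  have hl := lt_lam
  apply h.step_one_one
  · exact h.short_neg _ (by norm_num) (by linarith)
  · simpa using h00
  · exact h.short _ (by norm_num) (by linarith)
  · exact h.short _ (by norm_num) (by linarith)
  · exact h.short _ (by norm_num) (by linarith)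

lemma of_zero (h : InflationInductive P) (h00 : P 0 0 0) (h11 : P 1 1 0) (i j : Fin 2) : P i j 0 := by
  by_cases hij : i = j
  · subst hij
    rcases fin_two_cases i with rfl | rfl
    · exact h00
    · exact h11
  · exact h.of_not_occurs _ _ _ fun ho => hij ho.eq_of_zero

lemma zero_one_lam (h : InflationInductive P) (h0 : ∀ i j, P i j 0) : P 0 1 lam := by
  have hl := lt_lam
  apply h.step_zero_one <;> intro i
  · simpa using h0 i 0
  · exact h.short_neg _ (by linarith) (by linarith)
  · exact h.short_neg _ (by linarith) (by linarith)

/-- The finitely many small differences are treated in order of dependence: `11` at `1` and `01` at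
`lam` rest on `0`, and `hlam` then gives `00` at `lam`. Next comes `lam + 1` starting from type `0`.
The remaining pairs starting from type `1` need only these, since `(lam + 3) / lam = lam` and `(2 *
lam + 3) / lam = lam + 1`. -/
lemma of_lt_four (h : InflationInductive P) (h00 : P 0 0 0) (h11 : P 1 1 0)
    (hlam : P 1 1 1 → P 0 1 lam → P 0 0 lam) {z : ℝ} (i j : Fin 2) (hz : 0 ≤ z) (hz' : z < 4) :
    P i j z := by
  have hl := lt_lam
  have hl' := lam_lt
  have hl0 := lam_pos.ne'
  have h0 := h.of_zero h00 h11
  have a11 := h.one_one_one h00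
  have a01 := h.zero_one_lam h0
  have a00 := hlam a11 a01
  have b : ∀ k, P 0 k lam := fun k => by rcases fin_two_cases k with rfl | rfl <;> assumption
  have e1 : (lam + 3) / lam = lam := by rw [← lam_sq]; field_simp
  have e2 : (2 * lam + 3) / lam = lam + 1 := by
    rw [show 2 * lam + 3 = lam * (lam + 1) by linarith [lam_sq]]; field_simp
  have c : ∀ k, P 0 k (lam + 1) := fun k => by
    rcases fin_two_cases k with rfl | rfl
    · apply h.step_zero_zero
      intro i j
      apply h.gap <;> linarith
    · apply h.step_zero_one <;> intro i
      · apply h.gap <;> linarith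
      · simpa using h0 i 0
      · exact h.short_neg _ (by linarith) (by linarith)
  have gap' : ∀ k w, lam < w → w < 4 * lam → w ≠ 2 * lam → w ≠ lam + 3 → w ≠ 3 * lam →
      w ≠ 2 * lam + 3 → P 0 k (w / lam) := fun k w h1 h2 => h.gap 0 k (by linarith) h2 h1.ne'
  by_cases ho : Occurs i j z
  swap
  · exact h.of_not_occurs _ _ _ ho
  have hs : ∀ k z, 0 < z → z < lam → P 0 k z := fun k z h1 h2 =>
    h.of_not_occurs _ _ _ fun ho => absurd (ho.tileLength_le h1) (not_le.2 h2)
  rcases ho.eq_of_lt_four hz hz' with rfl | rfl | rfl | rfl | rfl | rfl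
  · exact h0 i j
  · rcases fin_two_cases i with rfl | rfl
    · exact hs _ _ (by norm_num) (by linarith)
    rcases fin_two_cases j with rfl | rfl
    · apply h.step_one_zero <;> intro k
      · apply gap' <;> linarith
      · apply gap' <;> linarith
      · rw [show 1 + lam + 2 = lam + 3 by ring, e1]; exact b k
    · exact a11
  · rcases fin_two_cases i with rfl | rfl
    · exact hs _ _ (by norm_num) (by linarith)
    rcases fin_two_cases j with rfl | rfl
    · apply h.step_one_zero <;> intro k
      · apply gap' <;> linarith
      · rw [show 2 + lam + 1 = lam + 3 by ring, e1]; exact b k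
      · apply gap' <;> linarith
    · apply h.step_one_one
      · simpa using h00
      all_goals exact h.short _ (by norm_num) (by linarith)
  · rcases fin_two_cases i with rfl | rfl
    · rcases fin_two_cases j with rfl | rfl
      · apply h.step_zero_zero
        intro i j
        apply h.gap <;> linarith
      · apply h.step_zero_one <;> intro i
        · apply h.gap <;> linarith
        · exact h.short_neg _ (by linarith) (by linarith)
        · exact h.short_neg _ (by linarith) (by linarith)
    rcases fin_two_cases j with rfl | rfl
    · apply h.step_one_zero <;> intro k
      · rw [show 3 + lam = lam + 3 by ring, e1]; exact b k
      · apply gap' <;> linarith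
      · apply gap' <;> linarith
    · apply h.step_one_one
      all_goals exact h.short _ (by norm_num) (by linarith)
  · rcases fin_two_cases i with rfl | rfl
    · exact b j
    rcases fin_two_cases j with rfl | rfl
    · apply h.step_one_zero <;> intro k
      · rw [show (lam + lam) / lam = 2 by field_simp; norm_num]
        exact hs _ _ (by norm_num) (by linarith)
      · apply gap' <;> linarith
      · apply gap' <;> linarith
    · apply h.step_one_one
      all_goals exact h.short _ (by linarith) (by linarith)
  · rcases fin_two_cases i with rfl | rfl
    · exact c j
    rcases fin_two_cases j with rfl | rfl
    · apply h.step_one_zero <;> intro k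
      · apply gap' <;> linarith
      · apply gap' <;> linarith
      · rw [show lam + 1 + lam + 2 = 2 * lam + 3 by ring, e2]; exact c k
    · apply h.step_one_one
      on_goal 5 => rw [show lam + 1 + 2 = lam + 3 by ring, e1]; exact a00
      all_goals exact h.short _ (by linarith) (by linarith)

/-- Induction along the inflation. -/
theorem forall_pairs (h : InflationInductive P) (h00 : P 0 0 0) (h11 : P 1 1 0)
    (hlam : P 1 1 1 → P 0 1 lam → P 0 0 lam) (i j : Fin 2) (z : ℝ) : P i j z := by
  have hl := lam_pos
  -- Offsets differ by at most `lam + 2`, and `lam + 1` is the fixed point of `z ↦ (z + lam + 2) /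
  -- lam`, so the excess over `lam + 1` shrinks by the factor `lam` at each step. For `n = 0` the
  -- bound is `4`.
  have main : ∀ n : ℕ, ∀ i j z, |z| < lam + 1 + lam ^ n * (3 - lam) → P i j z := by
    intro n
    induction n with
    | zero =>
      intro i j z hz
      rw [pow_zero, one_mul] at hz
      rcases le_total 0 z with h0 | h0
      · rw [abs_of_nonneg h0] at hz
        exact h.of_lt_four h00 h11 hlam i j h0 (by linarith)
      · rw [abs_of_nonpos h0] at hz
        rw [← neg_neg z]
        exact h.symm _ _ _ (h.of_lt_four h00 h11 hlam j i (by linarith) (by linarith))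
    | succ n ih =>
      intro i j z hz
      refine h.step i j z fun p hp q hq => ih _ _ _ ?_
      have h1 : |offset p.2 - offset q.2| ≤ lam + 2 :=
        abs_sub_le_iff.2 ⟨by linarith [offset_le hp, offset_nonneg q.2],
          by linarith [offset_le hq, offset_nonneg p.2]⟩
      rw [abs_div, abs_of_pos hl, div_lt_iff₀ hl, add_sub_assoc]
      have h2 := abs_add_le z (offset p.2 - offset q.2)
      have e : (lam + 1 + lam ^ n * (3 - lam)) * lam = lam + 1 + lam ^ (n + 1) * (3 - lam)
          + (lam + 2) := by
        rw [pow_succ]; linear_combination lam_sq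
      rw [e]
      linarith
  obtain ⟨n, hn⟩ := pow_unbounded_of_one_lt (2 * |z|) (by linarith [lt_lam] : 1 < lam)
  exact main n i j z (by nlinarith [lt_lam, lam_lt, abs_nonneg z])

end InflationInductive

end Induction

/-! ### Existence of the limit densities -/

lemma exists_tendsto_of_contraction {α : Type*} {l : Filter α} {σ : α → α} (hσ : Tendsto σ l l)
    {f : α → ℝ} {a β K : ℝ} (hβ : |β| < 1) (hK : ∀ᶠ x in l, |f x| ≤ K)
    (hf : Tendsto (fun x => f x - β * f (σ x)) l (𝓝 a)) : ∃ c, Tendsto f l (𝓝 c) := by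
  have hβ' : 1 - β ≠ 0 := by
    have := (abs_lt.1 hβ).2
    linarith
  obtain ⟨c, hc⟩ : ∃ c, a = c - β * c := ⟨a / (1 - β), by field_simp⟩
  refine ⟨c, ?_⟩
  -- Iterating along `σ` damps the a priori bound by `|β| ^ n`. The free `δ` absorbs the errors of
  -- the approximate recursion: half comes from the previous level, half from the current one.
  have key : ∀ n : ℕ, ∀ δ > 0, ∀ᶠ x in l, |f x - c| ≤ |β| ^ n * (K + |c|) + δ := by
    intro n
    induction n with
    | zero =>
      intro δ hδ
      filter_upwards [hK] with x hx
      have := abs_sub (f x) c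
      rw [pow_zero]
      linarith
    | succ n ih =>
      intro δ hδ
      filter_upwards [hσ.eventually (ih (δ / 2) (by positivity)),
        Metric.tendsto_nhds.1 hf (δ / 2) (by positivity)] with x hx hx'
      rw [Real.dist_eq, hc] at hx'
      have h1 : f x - c = β * (f (σ x) - c) + (f x - β * f (σ x) - (c - β * c)) := by ring
      have h2 : |β * (f (σ x) - c)| ≤ |β| * (|β| ^ n * (K + |c|) + δ / 2) := by
        rw [abs_mul]; gcongr
      rw [h1, pow_succ]
      have h3 : |β| * (δ / 2) ≤ δ / 2 := mul_le_of_le_one_left (by positivity) hβ.le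
      have := abs_add_le (β * (f (σ x) - c)) (f x - β * f (σ x) - (c - β * c))
      linarith
  rw [Metric.tendsto_nhds]
  intro ε hε
  have h0 : Tendsto (fun n : ℕ => |β| ^ n * (K + |c|)) atTop (𝓝 0) := by
    simpa using (tendsto_pow_atTop_nhds_zero_of_lt_one (abs_nonneg β) hβ).mul_const (K + |c|)
  obtain ⟨n, hn⟩ := (h0.eventually (gt_mem_nhds (by positivity : 0 < ε / 2))).exists
  filter_upwards [key n (ε / 3) (by positivity)] with x hx
  rw [Real.dist_eq]
  linarith

/-- The equations that relate a function on pairs of types and differences to itself along the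
inflation. -/
def InflationEquation (ν : Fin 2 → Fin 2 → ℝ → ℝ) : Prop :=
  ∀ i j z, ν i j z = 1 / lam * ∑ p ∈ parents i, ∑ q ∈ parents j,
    ν p.1 q.1 ((z + offset p.2 - offset q.2) / lam)

/-- The coefficients `3`, `2`, `1` in the equation for `ν 1 1` count the pairs of positions of the
letter `1` in `0111` whose difference is `0`, `±1`, `±2`. -/
lemma renormalisation_iff {ν : Fin 2 → Fin 2 → ℝ → ℝ} :
    Renormalisation ν ↔ InflationEquation ν := by
  have h : ∀ F : Fin 2 → Fin 2 → Prop, (∀ i j, F i j) ↔ (F 0 0 ∧ F 0 1 ∧ F 1 0 ∧ F 1 1) := by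
    intro F; simp only [Fin.forall_fin_two]; tauto
  rw [InflationEquation, h fun i j => ∀ z, _, Renormalisation]
  have a : ∀ z k l : ℝ, z + (lam + k) - (lam + l) = z + (k - l) := fun z k l => by ring
  have b : ∀ z k : ℝ, z - (lam + k) = z - k - lam := fun z k => by ring
  have b' : ∀ z k : ℝ, z + (lam + k) = z + k + lam := fun z k => by ring
  have d : ∀ z k : ℝ, z + lam - k - lam = z - k := fun z k => by ring
  have d1 : ∀ z : ℝ, z + 1 - 2 = z - 1 := fun z => by ring
  have d2 : ∀ z : ℝ, z + 2 - 1 = z + 1 := fun z => by ring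
  refine and_congr ?_ (and_congr ?_ (and_congr ?_ ?_)) <;> refine forall_congr' fun z => ?_ <;>
    refine Eq.congr_right (congrArg _ ?_) <;>
    norm_num [parents, offset, a, b, b', d, d1, d2, ← sub_eq_add_neg] <;> ring

lemma InflationEquation.swap {ν : Fin 2 → Fin 2 → ℝ → ℝ} (h : InflationEquation ν) :
    InflationEquation fun i j z => ν j i (-z) := by
  intro i j z
  simp only
  rw [h j i (-z), Finset.sum_comm]
  refine congrArg _ (Finset.sum_congr rfl fun p _ => Finset.sum_congr rfl fun q _ => ?_)
  congr 1
  ring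

lemma density_eq_zero {B : Fin 2 → Set ℝ} (hB : IsLegal B) {i j : Fin 2} {z : ℝ}
    (h : ¬ Occurs i j z) (r : ℝ) : density i j z (r, B) = 0 := by
  have : pairSet B i j z r = ∅ := by
    rw [Set.eq_empty_iff_forall_notMem]
    exact fun x hx => h ⟨B, hB, x, hx.1, hx.2.1⟩
  simp [density, this]

/-- Reversing a pair shifts the pattern and passing to parents deflates it. Uniformity over all
legal patterns makes the convergence survive both. -/
lemma inductive_density :
    InflationInductive fun i j z => ∃ c, Tendsto (density i j z) legalFilter (𝓝 c) where
  of_not_occurs i j z h := by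
    refine ⟨0, tendsto_const_nhds.congr' ?_⟩
    filter_upwards [eventually_isLegal] with p hp
    exact (density_eq_zero hp h p.1).symm
  symm i j z := by
    rintro ⟨c, hc⟩
    refine ⟨c, (hc.comp (tendsto_shift z)).congr fun p => ?_⟩
    exact (density_neg j i z p.1 p.2).symm
  step i j z h := by
    choose! c hc using h
    refine ⟨_, Tendsto.congr' ?_ ((tendsto_finsetSum (parents i) fun p hp =>
      tendsto_finsetSum (parents j) fun q hq =>
        (hc p hp q hq).comp (tendsto_deflate (offset p.2 / lam))).const_mul (1 / lam))⟩
    filter_upwards [eventually_isLegal] with p hp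
    exact (density_eq hp i j z p.1).symm

lemma not_occurs_zero {i j : Fin 2} (h : i ≠ j) : ¬ Occurs i j 0 := fun ho => h ho.eq_of_zero

lemma not_occurs_one (j : Fin 2) : ¬ Occurs 0 j 1 := fun ho => by
  have := ho.tileLength_le one_pos
  simp only [tileLength] at this
  linarith [lt_lam]

lemma tendsto_length :
    Tendsto (fun p => lam * density 0 0 0 p + density 1 1 0 p) legalFilter (𝓝 1) := by
  rw [tendsto_iff_norm_sub_tendsto_zero]
  have h0 : Tendsto (fun p : ℝ × (Fin 2 → Set ℝ) => lam / (2 * p.1)) legalFilter (𝓝 0) :=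
    (tendsto_fst.const_mul_atTop two_pos).const_div_atTop lam
  refine tendsto_of_tendsto_of_tendsto_of_le_of_le' tendsto_const_nhds h0
    (Eventually.of_forall fun p => norm_nonneg _) ?_
  filter_upwards [eventually_isLegal, eventually_ge lam] with p hp hr
  have hr0 : 0 < p.1 := lam_pos.trans_le hr
  have : lam * density 0 0 0 p + density 1 1 0 p - 1 =
      (lam * (pairSet p.2 0 0 0 p.1).ncard + (pairSet p.2 1 1 0 p.1).ncard - 2 * p.1)
        / (2 * p.1) := by
    unfold density
    field_simp
  rw [this, Real.norm_eq_abs, abs_div, abs_of_pos (by positivity : 0 < 2 * p.1)]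
  gcongr
  exact abs_length_sub_le hp hr

/-- Every `0` starts the image of one tile, so `density 0 0 0` at radius `r` is `1 / lam` times the
sum of the densities of both types at `r / lam`. Eliminating type `1` by `tendsto_length` leaves a
recursion with factor `(1 - lam) / lam`. -/
lemma exists_tendsto_density_zero : ∃ c, Tendsto (density 0 0 0) legalFilter (𝓝 c) := by
  have hl := lt_lam
  have hl0 := lam_pos
  refine exists_tendsto_of_contraction (tendsto_deflate 0) (β := (1 - lam) / lam) (K := 2)
    (a := 1 / lam * 1) ?_ ?_ ?_
  · rw [abs_div, abs_of_pos hl0, div_lt_one hl0, abs_lt]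
    constructor <;> linarith
  · filter_upwards [tendsto_length.eventually (gt_mem_nhds (by norm_num : (1 : ℝ) < 2)),
      eventually_ge 0] with p hp hr
    have h0 := density_nonneg (i := 0) (j := 0) (z := 0) hr
    have h1 := density_nonneg (i := 1) (j := 1) (z := 0) hr
    rw [abs_of_nonneg h0]
    nlinarith
  · refine ((tendsto_length.comp (tendsto_deflate 0)).const_mul (1 / lam)).congr' ?_
    filter_upwards [eventually_isLegal] with p hp
    have hq := hp.deflate.shift 0
    have := density_eq hp 0 0 0 p.1
    simp [parents, offset, density_eq_zero hq (not_occurs_zero (i := 0) (j := 1) (by simp)),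
      density_eq_zero hq (not_occurs_zero (i := 1) (j := 0) (by simp))] at this
    rw [this]
    simp only [Function.comp]
    field_simp
    ring

lemma exists_tendsto_density_one :
    ∃ c, Tendsto (density 1 1 0) legalFilter (𝓝 c) := by
  obtain ⟨c, hc⟩ := exists_tendsto_density_zero
  exact ⟨_, (tendsto_length.sub (hc.const_mul lam)).congr fun p => by ring⟩

lemma density_le {B : Fin 2 → Set ℝ} (hB : IsLegal B) (i j : Fin 2) (z : ℝ) {r : ℝ} (hr : 0 ≤ r) :
    density i j z (r, B) ≤ density i i 0 (r, B) := by
  have hs : pairSet B i j z r ⊆ pairSet B i i 0 r :=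
    fun x hx => ⟨hx.1, by simpa using hx.1, hx.2.2⟩
  have := Set.ncard_le_ncard hs (finite_pairSet hB i i 0 r)
  unfold density
  exact div_le_div_of_nonneg_right (by exact_mod_cast this) (by positivity)

/-- Two deflations lead back to the start: `00` at `lam` comes from `11` or `10` at `1`, and `10` at
`1` comes, among others, from `00` at `(lam + 3) / lam = lam`. The loop has factor `1 / lam ^ 2`,
and every other contribution is known to converge. -/
lemma exists_tendsto_density_lam (h11 : ∃ c, Tendsto (density 1 1 1) legalFilter (𝓝 c))
    (h01 : ∃ c, Tendsto (density 0 1 lam) legalFilter (𝓝 c)) :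
    ∃ c, Tendsto (density 0 0 lam) legalFilter (𝓝 c) := by
  have hl := lt_lam
  have hl2 := lam_lt
  have hl0 := lam_pos
  have g : ∀ i w, 0 < w → w < 4 * lam → w ≠ lam → w ≠ 2 * lam → w ≠ lam + 3 → w ≠ 3 * lam →
      w ≠ 2 * lam + 3 → ∃ c, Tendsto (density 0 i (w / lam)) legalFilter (𝓝 c) :=
    fun i w a b c d e f g => inductive_density.gap 0 i a b c d e f g
  obtain ⟨a, ha⟩ := h11
  obtain ⟨b, hb⟩ := h01
  have g1 : ∀ i, ∃ c, Tendsto (density 0 i ((1 + lam) / lam)) legalFilter (𝓝 c) := fun i => by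
    apply g <;> linarith
  have g2 : ∀ i, ∃ c, Tendsto (density 0 i ((1 + (lam + 1)) / lam)) legalFilter (𝓝 c) :=
    fun i => by apply g <;> linarith
  choose c1 hc1 using g1
  choose c2 hc2 using g2
  obtain ⟨K, hK⟩ := exists_tendsto_density_zero
  have e : (1 + (lam + 2)) / lam = lam := by
    rw [div_eq_iff hl0.ne']; linarith [lam_sq]
  have t0 := tendsto_deflate 0
  have t : ∀ k : ℝ, Tendsto ((fun p : ℝ × (Fin 2 → Set ℝ) =>
      (p.1 / lam, shift (k / lam) (deflate p.2))) ∘ fun p => (p.1 / lam, shift 0 (deflate p.2)))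
      legalFilter legalFilter := fun k => (tendsto_deflate (k / lam)).comp t0
  refine exists_tendsto_of_contraction (t (lam + 2)) (β := 1 / lam ^ 2) (K := K + 1)
    (a := 1 / lam * (a + 1 / lam * ((c1 0 + c1 1) + (c2 0 + c2 1) + b))) ?_ ?_ ?_
  · rw [abs_of_pos (by positivity), div_lt_one (by positivity)]
    nlinarith
  · filter_upwards [hK.eventually (gt_mem_nhds (lt_add_one K)), eventually_ge 0,
      eventually_isLegal] with p hp hr hB
    rw [abs_of_nonneg (density_nonneg hr)]
    exact (density_le hB 0 0 lam hr).trans hp.le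
  · refine Tendsto.congr' ?_ (((ha.comp t0).add (((((hc1 0).comp (t lam)).add
      ((hc1 1).comp (t lam))).add (((hc2 0).comp (t (lam + 1))).add
      ((hc2 1).comp (t (lam + 1)))) |>.add (hb.comp (t (lam + 2)))).const_mul (1 / lam))).const_mul
      (1 / lam))
    filter_upwards [eventually_isLegal] with p hp
    have hq := hp.deflate.shift 0
    have e1 := density_eq hp 0 0 lam p.1
    have e2 := density_eq hq 1 0 1 (p.1 / lam)
    simp [parents, offset, hl0.ne', density_eq_zero hq (not_occurs_one _)] at e1
    simp [parents, offset, e] at e2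
    rw [e1, e2]
    simp only [Function.comp]
    field_simp
    ring

/-- Densities of pairs exist, uniformly in all legal patterns. -/
theorem exists_tendsto_density : ∃ c : Fin 2 → Fin 2 → ℝ → ℝ,
    ∀ i j z, Tendsto (density i j z) legalFilter (𝓝 (c i j z)) := by
  choose c hc using inductive_density.forall_pairs exists_tendsto_density_zero
    exists_tendsto_density_one exists_tendsto_density_lam
  exact ⟨c, hc⟩

/-! ### Positivity of the limit densities -/

lemma legalFilter_neBot {B : Fin 2 → Set ℝ} (hB : IsLegal B) : legalFilter.NeBot :=
  (tendsto_of_isLegal hB).neBot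

/-- The function `c` gives the limits of the densities of pairs. -/
def IsLimitDensity (c : Fin 2 → Fin 2 → ℝ → ℝ) : Prop :=
  ∀ i j z, Tendsto (density i j z) legalFilter (𝓝 (c i j z))

namespace IsLimitDensity

variable {c : Fin 2 → Fin 2 → ℝ → ℝ}

lemma nonneg [legalFilter.NeBot] (hc : IsLimitDensity c) (i j : Fin 2) (z : ℝ) : 0 ≤ c i j z :=
  ge_of_tendsto (hc i j z) ((eventually_ge 0).mono fun _ hp => density_nonneg hp)

lemma eq_zero [legalFilter.NeBot] (hc : IsLimitDensity c) {i j : Fin 2} {z : ℝ}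
    (h : ¬ Occurs i j z) : c i j z = 0 := by
  refine tendsto_nhds_unique (hc i j z) (tendsto_const_nhds.congr' ?_)
  filter_upwards [eventually_isLegal] with p hp
  exact (density_eq_zero hp h p.1).symm

lemma neg [legalFilter.NeBot] (hc : IsLimitDensity c) (i j : Fin 2) (z : ℝ) :
    c i j (-z) = c j i z := by
  refine tendsto_nhds_unique (hc i j (-z)) (((hc j i z).comp (tendsto_shift z)).congr fun p => ?_)
  exact (density_neg i j z p.1 p.2).symm

lemma inflationEquation [legalFilter.NeBot] (hc : IsLimitDensity c) : InflationEquation c := by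
  intro i j z
  refine tendsto_nhds_unique (hc i j z) (Tendsto.congr' ?_ ((tendsto_finsetSum (parents i)
    fun p _ => tendsto_finsetSum (parents j) fun q _ =>
      (hc p.1 q.1 ((z + offset p.2 - offset q.2) / lam)).comp
        (tendsto_deflate (offset p.2 / lam))).const_mul (1 / lam)))
  filter_upwards [eventually_isLegal] with p hp
  exact (density_eq hp i j z p.1).symm

lemma length [legalFilter.NeBot] (hc : IsLimitDensity c) : lam * c 0 0 0 + c 1 1 0 = 1 :=
  tendsto_nhds_unique (((hc 0 0 0).const_mul lam).add (hc 1 1 0)) tendsto_length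

end IsLimitDensity

lemma InflationEquation.zero_zero_zero {ν : Fin 2 → Fin 2 → ℝ → ℝ} (h : InflationEquation ν)
    (hν : ∀ i j z, ¬ Occurs i j z → ν i j z = 0) : lam * ν 0 0 0 = ν 0 0 0 + ν 1 1 0 := by
  have hl := lam_pos.ne'
  have h1 := h 0 0 0
  simp [parents, offset, hν 0 1 0 (not_occurs_zero (by simp)),
    hν 1 0 0 (not_occurs_zero (by simp))] at h1
  field_simp at h1
  linarith

namespace IsLimitDensity

variable {c : Fin 2 → Fin 2 → ℝ → ℝ}

lemma zero_pos [legalFilter.NeBot] (hc : IsLimitDensity c) : 0 < c 0 0 0 := by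
  have h1 := hc.inflationEquation.zero_zero_zero fun i j z => hc.eq_zero
  have h2 := hc.length
  have hl := lt_lam
  have h3 : c 0 0 0 * (2 * lam - 1) = 1 := by linarith
  by_contra! h
  nlinarith

lemma one_pos [legalFilter.NeBot] (hc : IsLimitDensity c) : 0 < c 1 1 0 := by
  have h1 := hc.inflationEquation.zero_zero_zero fun i j z => hc.eq_zero
  have h2 := hc.zero_pos
  nlinarith [lt_lam]

lemma pos_of_parents [legalFilter.NeBot] (hc : IsLimitDensity c) {i j : Fin 2} {z : ℝ}
    {p q : Fin 2 × ℕ} (hp : p ∈ parents i) (hq : q ∈ parents j)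
    (h : 0 < c p.1 q.1 ((z + offset p.2 - offset q.2) / lam)) : 0 < c i j z := by
  rw [hc.inflationEquation i j z]
  refine mul_pos (one_div_pos.2 lam_pos) (Finset.sum_pos' (fun _ _ => Finset.sum_nonneg fun _ _ =>
    hc.nonneg _ _ _) ⟨p, hp, Finset.sum_pos' (fun _ _ => hc.nonneg _ _ _) ⟨q, hq, h⟩⟩)

lemma pos [legalFilter.NeBot] (hc : IsLimitDensity c) {i j : Fin 2} {z : ℝ} (h : Occurs i j z) :
    0 < c i j z := by
  have hl := lam_pos.ne'
  refine InflationInductive.forall_pairs (P := fun i j z => Occurs i j z → 0 < c i j z)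
    ⟨fun i j z h h' => absurd h' h, fun i j z h h' => ?_, fun i j z h h' => ?_⟩
    (fun _ => hc.zero_pos) (fun _ => hc.one_pos) (fun _ _ _ => ?_) i j z h
  · rw [hc.neg]
    exact h (by simpa using h'.symm)
  · obtain ⟨p, hp, q, hq, ho⟩ := h'.exists_parents
    exact hc.pos_of_parents hp hq (h p hp q hq ho)
  · have h11 : 0 < c 1 1 1 := by
      refine hc.pos_of_parents (p := (0, 1)) (q := (0, 2)) (by simp [parents]) (by simp [parents]) ?_
      have : (1 + offset 1 - offset 2) / lam = 0 := by
        simp only [offset]; norm_num; left; ring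
      simp only [this]
      exact hc.zero_pos
    refine hc.pos_of_parents (p := (1, 0)) (q := (1, 0)) (by simp [parents]) (by simp [parents]) ?_
    have : (lam + offset 0 - offset 0) / lam = 1 := by simp [hl]
    simp only [this]
    exact h11

end IsLimitDensity

/-! ### Uniqueness of supported solutions -/

section Uniqueness

variable {ν : Fin 2 → Fin 2 → ℝ → ℝ}

/-- The same two-step loop as for the densities, now without other contributions: it yields `ν 0 0
lam * (lam ^ 2 - 1) = 0`. -/
lemma InflationEquation.lam_eq_zero (h : InflationEquation ν)
    (hν : ∀ i j z, ¬ Occurs i j z → ν i j z = 0) (h11 : ν 1 1 1 = 0) (h01 : ν 0 1 lam = 0) :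
    ν 0 0 lam = 0 := by
  have hl := lt_lam
  have hl2 := lam_lt
  have hl0 := lam_pos
  have e : (1 + (lam + 2)) / lam = lam := by
    rw [div_eq_iff hl0.ne']; linarith [lam_sq]
  have g : ∀ i w, lam < w → w < lam + 3 → ν 0 i (w / lam) = 0 := by
    intro i w h1 h2
    refine hν 0 i _ fun ho => ?_
    have := ho.tileLength_le (div_pos (by linarith) hl0)
    rw [show tileLength 0 = lam from rfl, le_div_iff₀ hl0] at this
    linarith [lam_sq]
  have g1 : ∀ i, ν 0 i ((1 + lam) / lam) = 0 := fun i => by apply g <;> linarith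
  have g2 : ∀ i, ν 0 i ((1 + (lam + 1)) / lam) = 0 := fun i => by apply g <;> linarith
  have e1 := h 0 0 lam
  have e2 := h 1 0 1
  simp [parents, offset, hl0.ne', hν _ _ _ (not_occurs_one _), h11] at e1
  simp [parents, offset, e, g1, g2, h01] at e2
  rw [e2] at e1
  field_simp at e1
  have : ν 0 0 lam * (lam ^ 2 - 1) = 0 := by linarith
  rcases mul_eq_zero.1 this with h | h
  · exact h
  · nlinarith

lemma InflationEquation.eq_zero (h : InflationEquation ν)
    (hν : ∀ i j z, ¬ Occurs i j z → ν i j z = 0) (h0 : ν 0 0 0 = 0) (i j : Fin 2) (z : ℝ) :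
    ν i j z = 0 := by
  have h1 : ν 1 1 0 = 0 := by
    have := h.zero_zero_zero hν
    rw [h0] at this
    linarith
  have hν' : ∀ i j z, ¬ Occurs i j z → ν j i (-z) = 0 := fun i j z hz =>
    hν _ _ _ fun ho => hz (by simpa using ho.symm)
  -- A solution is not assumed to be symmetric, so the predicate carries the reflected value as
  -- well; the reflection solves the same equations by `InflationEquation.swap`.
  refine (InflationInductive.forall_pairs (P := fun i j z => ν i j z = 0 ∧ ν j i (-z) = 0)
    ⟨fun i j z hz => ⟨hν i j z hz, hν' i j z hz⟩, fun i j z hz => ⟨hz.2, by simpa using hz.1⟩,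
      fun i j z hz => ⟨?_, ?_⟩⟩
    ⟨h0, by simpa using h0⟩ ⟨h1, by simpa using h1⟩
    (fun h11 h01 => ⟨h.lam_eq_zero hν h11.1 h01.1, h.swap.lam_eq_zero hν' h11.2 h01.2⟩) i j z).1
  · rw [h i j z, Finset.sum_eq_zero fun p hp => Finset.sum_eq_zero fun q hq => (hz p hp q hq).1,
      mul_zero]
  · rw [show ν j i (-z) = _ from h.swap i j z, Finset.sum_eq_zero fun p hp => Finset.sum_eq_zero fun q hq =>
      (hz p hp q hq).2, mul_zero]

end Uniqueness

/-! ### Transfer to the members of the hull -/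

section Hull

variable {A : Set ℝ}

lemma occurs_of_mem_typeDifferences (hA : A ∈ hull) {i j : Fin 2} {z : ℝ}
    (h : z ∈ typeDifferences A i j) : Occurs i j z := by
  obtain ⟨y, hy, x, hx, rfl⟩ := h
  exact ⟨_, isLegal_pointsOfType hA, x, hx, by simpa using hy⟩

lemma ncard_window (hA : A ∈ hull) (r : ℝ) :
    (A ∩ Set.Icc (-r) r).ncard =
      (pairSet (pointsOfType A) 0 0 0 r).ncard + (pairSet (pointsOfType A) 1 1 0 r).ncard := by
  have hB := isLegal_pointsOfType hA
  rw [← Set.ncard_union_eq _ (finite_pairSet hB 0 0 0 r) (finite_pairSet hB 1 1 0 r)]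
  · congr 1
    ext x
    have := mem_iff_exists_pointsOfType hA (x := x)
    rw [Fin.exists_fin_two] at this
    simp only [Set.mem_inter_iff, Set.mem_Icc, ← abs_le, pairSet, Set.mem_union, Set.mem_ofPred_eq,
      add_zero]
    tauto
  · rw [Set.disjoint_left]
    exact fun x hx hx' => absurd (hB.type_unique hx.1 hx'.1) (by simp)

/-- `pairFrequency` truncates both points whereas `density` truncates only the first, so its
numerator is squeezed between the counts for radii `r - |z|` and `r`. Dividing by the density of all
points changes the normalisation from length to number of points. -/
lemma tendsto_pairFrequency (hA : A ∈ hull) {c : Fin 2 → Fin 2 → ℝ → ℝ} (hc : IsLimitDensity c)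
    (i j : Fin 2) (z : ℝ) :
    Tendsto (pairFrequency A i j z) atTop (𝓝 (c i j z / (c 0 0 0 + c 1 1 0))) := by
  have hB := isLegal_pointsOfType hA
  have := legalFilter_neBot hB
  have ht := fun i j z => (hc i j z).comp (tendsto_of_isLegal hB)
  have hpos : c 0 0 0 + c 1 1 0 ≠ 0 := by linarith [hc.zero_pos, hc.one_pos]
  set S : ℝ → Set ℝ := fun r => pointsOfType A i ∩ Set.Icc (-r) r ∩
    translate (-z) (pointsOfType A j ∩ Set.Icc (-r) r) with hS
  have hmem : ∀ r x, x ∈ S r ↔ x ∈ pointsOfType A i ∧ |x| ≤ r ∧ x + z ∈ pointsOfType A j ∧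
      |x + z| ≤ r := fun r x => by
    simp only [hS, Set.mem_inter_iff, mem_translate, Set.mem_Icc, ← abs_le, sub_neg_eq_add]
    tauto
  have hlow : ∀ r, pairSet (pointsOfType A) i j z (r - |z|) ⊆ S r := fun r x hx => by
    rw [hmem]
    exact ⟨hx.1, by linarith [hx.2.2, abs_nonneg z], hx.2.1, by
      linarith [hx.2.2, abs_add_le x z]⟩
  have hup : ∀ r, S r ⊆ pairSet (pointsOfType A) i j z r := fun r x hx => by
    rw [hmem] at hx
    exact ⟨hx.1, hx.2.2.1, hx.2.1⟩
  have hnum : Tendsto (fun r => ((S r).ncard : ℝ) / (2 * r)) atTop (𝓝 (c i j z)) := by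
    have h1 : Tendsto (fun r : ℝ => r - |z|) atTop atTop :=
      tendsto_atTop_add_const_right _ _ tendsto_id
    have h2 : Tendsto (fun r : ℝ => 1 - |z| / r) atTop (𝓝 1) := by
      simpa using (tendsto_id.const_div_atTop |z|).const_sub 1
    have h3 := ((ht i j z).comp h1).mul h2
    rw [mul_one] at h3
    refine tendsto_of_tendsto_of_tendsto_of_le_of_le' h3 (ht i j z) ?_ ?_
    · filter_upwards [eventually_gt_atTop |z|] with r hr
      have hr0 : 0 < r := (abs_nonneg z).trans_lt hr
      have hr1 : r - |z| ≠ 0 := by linarith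
      have := Set.ncard_le_ncard (hlow r) ((finite_pairSet hB i j z r).subset (hup r))
      simp only [Function.comp, density]
      rw [show ((pairSet (pointsOfType A) i j z (r - |z|)).ncard : ℝ) / (2 * (r - |z|)) *
        (1 - |z| / r) = (pairSet (pointsOfType A) i j z (r - |z|)).ncard / (2 * r) by field_simp]
      gcongr
    · filter_upwards [eventually_gt_atTop 0] with r hr
      have := Set.ncard_le_ncard (hup r) (finite_pairSet hB i j z r)
      simp only [Function.comp, density]
      gcongr
  refine (hnum.div ((ht 0 0 0).add (ht 1 1 0)) hpos).congr' ?_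
  filter_upwards [eventually_gt_atTop 0] with r hr
  simp only [pairFrequency, ncard_window hA, Pi.div_apply, Function.comp, density]
  push_cast
  rw [← add_div, div_div_div_cancel_right₀ (by positivity)]

lemma finrank_solutionSpace (hA : A ∈ hull) {ν : Fin 2 → Fin 2 → ℝ → ℝ}
    (hν : ν ∈ solutionSpace A) (h0 : ν 0 0 0 ≠ 0) :
    Module.finrank ℝ (solutionSpace A) = 1 := by
  refine (finrank_eq_one_iff_of_nonzero' (⟨ν, hν⟩ : solutionSpace A) fun h => h0 ?_).2 fun μ => ?_
  · rw [show ν = 0 from congrArg Subtype.val h]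
    rfl
  · refine ⟨μ.1 0 0 0 / ν 0 0 0, ?_⟩
    set a := μ.1 0 0 0 / ν 0 0 0 with ha
    have hm : μ.1 - a • ν ∈ solutionSpace A :=
      Submodule.sub_mem _ μ.2 (Submodule.smul_mem _ a hν)
    have hz := (renormalisation_iff.1 hm.1).eq_zero
      (fun i j z hz => hm.2 i j z fun h => hz (occurs_of_mem_typeDifferences hA h))
      (by simp [ha, h0])
    refine Subtype.ext (funext fun i => funext fun j => funext fun z => ?_)
    have := hz i j z
    simp only [Pi.sub_apply, Pi.smul_apply] at this
    exact (sub_eq_zero.1 this).symm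

/-- The pair correlations of a member of the hull are multiples of the limit densities. -/
lemma pairCorrelation_eq (hA : A ∈ hull) {c : Fin 2 → Fin 2 → ℝ → ℝ} (hc : IsLimitDensity c) :
    pairCorrelation A = fun i j z => c i j z / (c 0 0 0 + c 1 1 0) :=
  funext fun i => funext fun j => funext fun z => (tendsto_pairFrequency hA hc i j z).limUnder_eq

lemma InflationEquation.div {ν : Fin 2 → Fin 2 → ℝ → ℝ} (h : InflationEquation ν) (a : ℝ) :
    InflationEquation fun i j z => ν i j z / a := by
  intro i j z
  simp only [← Finset.sum_div]
  rw [← mul_div_assoc, ← h i j z]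

/-- The limit is the same along every legal pattern. A difference missing from `A` has zero density
along `A`, while one that occurs in `A` has positive density by `IsLimitDensity.pos`. -/
lemma IsLimitDensity.support_eq (hA : A ∈ hull) {c : Fin 2 → Fin 2 → ℝ → ℝ}
    (hc : IsLimitDensity c) (i j : Fin 2) : Function.support (c i j) = typeDifferences A i j := by
  have hB := isLegal_pointsOfType hA
  have := legalFilter_neBot hB
  ext z
  refine ⟨fun hz => ?_, fun hz => (hc.pos (occurs_of_mem_typeDifferences hA hz)).ne'⟩
  by_contra hn
  refine hz (tendsto_nhds_unique ((hc i j z).comp (tendsto_of_isLegal hB))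
    (tendsto_const_nhds.congr fun r => ?_))
  have : pairSet (pointsOfType A) i j z r = ∅ := by
    rw [Set.eq_empty_iff_forall_notMem]
    exact fun x hx => hn ⟨x + z, hx.2.1, x, hx.1, by ring⟩
  simp [density, this]

end Hull

end InflationTiling

open InflationTiling in
theorem theorem2 (Λ : Set ℝ) (hΛ : Λ ∈ InflationTiling.hull) :
    (∀ (i j : Fin 2) (z : ℝ),
      Tendsto (InflationTiling.pairFrequency Λ i j z) atTop
        (𝓝 (InflationTiling.pairCorrelation Λ i j z))) ∧
    InflationTiling.Renormalisation (InflationTiling.pairCorrelation Λ) ∧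
    (∀ i j : Fin 2, Function.support (InflationTiling.pairCorrelation Λ i j) =
      InflationTiling.typeDifferences Λ i j) ∧
    Module.finrank ℝ (InflationTiling.solutionSpace Λ) = 1 := by
  have := legalFilter_neBot (isLegal_pointsOfType hΛ)
  obtain ⟨c, hc⟩ : ∃ c, IsLimitDensity c := exists_tendsto_density
  have hκ : c 0 0 0 + c 1 1 0 ≠ 0 := by linarith [hc.zero_pos, hc.one_pos]
  have hren : Renormalisation (pairCorrelation Λ) := by
    rw [pairCorrelation_eq hΛ hc, renormalisation_iff]
    exact hc.inflationEquation.div _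
  have hsupp : ∀ i j, Function.support (pairCorrelation Λ i j) = typeDifferences Λ i j := by
    intro i j
    rw [← hc.support_eq hΛ, pairCorrelation_eq hΛ hc]
    ext z
    simp [hκ]
  refine ⟨fun i j z => ?_, hren, hsupp, finrank_solutionSpace hΛ (ν := pairCorrelation Λ)
    ⟨hren, fun i j z hz => ?_⟩ ?_⟩
  · rw [pairCorrelation_eq hΛ hc]
    exact tendsto_pairFrequency hΛ hc i j z
  · rw [← hsupp] at hz
    exact Function.notMem_support.1 hz
  · rw [pairCorrelation_eq hΛ hc]
    exact (div_pos hc.zero_pos (add_pos hc.zero_pos hc.one_pos)).ne'
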